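/- Let $I\subseteq\mathbb R$ be a nonempty open interval and let $H,K\colon I\to\mathbb R$ be smooth, with $H(u)\neq 0$ for all $u\in I$ and $(H',K')\not\equiv(0,0)$. Consider the nonlinear equation $$u_{tt}=(H(u)u_x)_x+K(u)u_x\qquad (u\in I).\tag{1}$$ *Separable solutions.* Let $q\colon I\to\mathbb R$ be smooth with $q'\ne0$ everywhere. Equation (1) is said to possess the functionally separable solution $$q(u)=\varphi(t)+\psi(x)\tag{2}$$ if the ansatz (2) is compatible with (1), i.e. every 2-jet satisfying (1) and $q(u)_{xt}=0$ is the 2-jet of a local smooth solution of (1) of the form (2). Explicitly: for every point $(t_0,x_0)$ and all prescribed values $u\in I$, $u_t,u_x,u_{xx}\in\mathbb R$ at that point, there is a smooth $I$-valued solution of (1) near $(t_0,x_0)$ which has these values at $(t_0,x_0)$ and satisfies (2) for some functions $\varphi,\psi$. *Equivalence.* The group $G^\sim$ acts on the equations (1) by $$\tilde t=\epsilon_4t+\epsilon_1,\quad \tilde x=\epsilon_5x+\epsilon_2,\quad \tilde u=\epsilon_6u+\epsilon_3,\quad \tilde H=\epsilon_4^{-2}\epsilon_5^{2}H,\quad \tilde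 K=\epsilon_4^{-2}\epsilon_5K,$$ with real constants $\epsilon_1,\dots,\epsilon_6$, $\epsilon_4\epsilon_5\epsilon_6\ne0$. The transformed equation is considered on the image $J$ of $I$ under $u\mapsto\tilde u$. **Theorem.** Equation (1) possesses the functionally separable solution (2) for some $q$ if and only if it is $G^\sim$-equivalent to one of the following equations, each considered for $u$ in an open interval $J$ and listed with its separable solution: - (a) $u_{tt}=\sigma\big[(e^{u}u_x)_x+\epsilon e^{u}u_x\big]$, $\quad u=\varphi(t)+\psi(x)$; - (b) $u_{tt}=\sigma\big[(u^{\mu}u_x)_x+\epsilon u^{\mu}u_x\big]$, $J\subseteq(0,\infty)$, $\quad \ln u=\varphi(t)+\psi(x)$ (that is, $u$ is a product of a function of $t$ and a function of $x$); - (c) $u_{tt}=\big((e^u-1)^{-1}u_x\big)_x$, $0\notin J$, $\quad \ln|e^u-1|=\varphi(t)+\psi(x)$; - (d) $u_{tt}=\sigma\big(e^u(e^u+1)^{-1}u_x\big)_x$, $\quad u-\ln(e^u+1)=\varphi(t)+\psi(x)$; - (e) $u_{tt}=\big(e^u(e^u-1)^{-1}u_x\big)_x$, $0\notin J$, $\quad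 -u+\ln|e^u-1|=\varphi(t)+\psi(x)$; - (f) $u_{tt}=\sigma\big((e^u+1)^{-1}u_x\big)_x$, $\quad \ln(e^u+1)=\varphi(t)+\psi(x)$; - (g) $u_{tt}=\Big(\sigma\,\dfrac{h'^2+ah'+b}{h^2}\,u_x\Big)_x+K(u)u_x$, $\quad q(u)=\varphi(t)+\psi(x)$ with $q'=1/h$. Here $\epsilon\in\{0,1\}$, $\sigma\in\{1,-1\}$, $\mu\neq0$. In (g), $a,b,h_0$ are nonzero constants and $h=h(u)$ is a smooth function on $J$, with $h\neq0$ and $h'^2+ah'+b\ne0$ on $J$, that satisfies $$hh''-h'^2=ah'+b$$ and, with $\Delta=a^2-4b$, the implicit relation $$\Big(h'+\frac a2\Big)e^{a/(2h'+a)}=\frac h{h_0}\quad\text{if }\Delta=0,$$ $$\Big|h'+\frac{a+\sqrt\Delta}2\Big|^{\sqrt\Delta+a}\Big|h'+\frac{a-\sqrt\Delta}2\Big|^{\sqrt\Delta-a}=\Big|\frac h{h_0}\Big|^{2\sqrt\Delta}\quad\text{if }\Delta>0,$$ $$\Big[1+\Big(\frac{2h'+a}{\sqrt{-\Delta}}\Big)^2\Big]\exp\Big[-\frac{2a}{\sqrt{-\Delta}}\arctan\frac{2h'+a}{\sqrt{-\Delta}}\Big]=\Big(\frac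 h{h_0}\Big)^2\quad\text{if }\Delta<0.$$ (Where $h'\ne0$, writing the relation as $h'=p_i(h)$, $i=1,2,3$ in the three cases, one has $u=\int^h\frac{dz}{p_i(z)}$ and $q=\int^h\frac{dz}{z\,p_i(z)}$.) The function $K$ in (g) is smooth and satisfies, with $g=-h'/h$ and $H$ the coefficient in (g), $$K'-K\frac{H'}H=0,\qquad K''-g'K-(gK+K')\frac{H'}H+K(3g'-2g^2)=0.$$ Moreover, for a given $q$, equation (1) possesses the functionally separable solution (2) if and only if there is an equivalence as above to a listed equation for which $q(u)=\alpha\,\tilde q(\tilde u)+\beta$ with constants $\alpha\neq0$, $\beta$, where $\tilde q(u)=\varphi(t)+\psi(x)$ is the separable solution listed with that equation. In particular, each listed equation possesses the separable solution listed with it. -/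

import Mathlib

open Set
open scoped ContDiff

/-- `u` is a smooth solution, on the set `U` of the `(t, x)`-plane and with values in `I`, of
`u_tt = (H(u) u_x)_x + K(u) u_x`. -/
def IsSolutionOn (I : Set ℝ) (H K : ℝ → ℝ) (U : Set (ℝ × ℝ)) (u : ℝ → ℝ → ℝ) : Prop :=
  ContDiffOn ℝ ∞ (fun p : ℝ × ℝ => u p.1 p.2) U ∧
  ∀ t x : ℝ, (t, x) ∈ U →
    u t x ∈ I ∧
    deriv (fun s => deriv (fun r => u r x) s) t
      = deriv (fun y => H (u t y) * deriv (fun z => u t z) y) x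
        + K (u t x) * deriv (fun y => u t y) x

/-- On the set `U`, `u` has the functionally separated form `q(u) = φ(t) + ψ(x)`. -/
def IsSeparatedOn (q : ℝ → ℝ) (U : Set (ℝ × ℝ)) (u : ℝ → ℝ → ℝ) : Prop :=
  ∃ φ ψ : ℝ → ℝ, ∀ t x : ℝ, (t, x) ∈ U → q (u t x) = φ t + ψ x

/-- The equation `u_tt = (H(u) u_x)_x + K(u) u_x`, with `u` in `I`, possesses the functionally
separable solution `q(u) = φ(t) + ψ(x)`, where `q` is smooth with `q' ≠ 0`: the ansatz is
compatible with the equation, i.e. every 2-jet that satisfies the equation and `q(u)_xt = 0` is the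
2-jet of a local solution of the separated form. Such 2-jets are parametrized freely by the values
of `u, u_t, u_x, u_xx`, because the two relations determine `u_tt` and `u_xt`. -/
def PossessesSeparableSolution (I : Set ℝ) (H K q : ℝ → ℝ) : Prop :=
  ContDiffOn ℝ ∞ q I ∧ (∀ v ∈ I, deriv q v ≠ 0) ∧
  ∀ t₀ x₀ : ℝ, ∀ u₀ ∈ I, ∀ ut ux uxx : ℝ,
    ∃ (U : Set (ℝ × ℝ)) (u : ℝ → ℝ → ℝ),
      IsOpen U ∧ (t₀, x₀) ∈ U ∧ IsSolutionOn I H K U u ∧ IsSeparatedOn q U u ∧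
      u t₀ x₀ = u₀ ∧
      deriv (fun s => u s x₀) t₀ = ut ∧
      deriv (fun y => u t₀ y) x₀ = ux ∧
      deriv (fun y => deriv (fun z => u t₀ z) y) x₀ = uxx

/-- An equivalence transformation
`t' = e₄ t + e₁`, `x' = e₅ x + e₂`, `u' = e₆ u + e₃`, `H' = e₄⁻² e₅² H`, `K' = e₄⁻² e₅ K`. -/
structure EquivTransformation where
  e₁ : ℝ
  e₂ : ℝ
  e₃ : ℝ
  e₄ : ℝ
  e₅ : ℝ
  e₆ : ℝ
  e₄_ne : e₄ ≠ 0
  e₅_ne : e₅ ≠ 0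
  e₆_ne : e₆ ≠ 0

/-- The action on the dependent variable. -/
def EquivTransformation.onU (τ : EquivTransformation) (u : ℝ) : ℝ := τ.e₆ * u + τ.e₃

/-- `τ` carries the equation with coefficients `H, K` on `I` to the one with `H', K'` on `J`. -/
def EquivTransformation.Carries (τ : EquivTransformation)
    (I : Set ℝ) (H K : ℝ → ℝ) (J : Set ℝ) (H' K' : ℝ → ℝ) : Prop :=
  τ.onU '' I = J ∧
  ∀ u ∈ I, H' (τ.onU u) = H u * (τ.e₅ ^ 2 / τ.e₄ ^ 2) ∧
    K' (τ.onU u) = K u * (τ.e₅ / τ.e₄ ^ 2)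

/-- The implicit relation between `z = h` and `p = h'` that defines `p = pᵢ(z)`, where `i = 1, 2, 3`
according to whether `Δ = a² - 4b` is zero, positive or negative. -/
def ImplicitRelation (a b h₀ z p : ℝ) : Prop :=
  (a ^ 2 - 4 * b = 0 →
    (p + a / 2) * Real.exp (a / (2 * p + a)) = z / h₀) ∧
  (0 < a ^ 2 - 4 * b →
    |p + (a + √(a ^ 2 - 4 * b)) / 2| ^ (√(a ^ 2 - 4 * b) + a)
      * |p + (a - √(a ^ 2 - 4 * b)) / 2| ^ (√(a ^ 2 - 4 * b) - a)
      = |z / h₀| ^ (2 * √(a ^ 2 - 4 * b))) ∧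
  (a ^ 2 - 4 * b < 0 →
    (1 + ((2 * p + a) / √(-(a ^ 2 - 4 * b))) ^ 2)
      * Real.exp (-2 * (a / √(-(a ^ 2 - 4 * b)))
          * Real.arctan ((2 * p + a) / √(-(a ^ 2 - 4 * b))))
      = (z / h₀) ^ 2)

/-- The two equations that restrict `K` when `H` and `g` are given. -/
def KEquations (J : Set ℝ) (H K g : ℝ → ℝ) : Prop :=
  ContDiffOn ℝ ∞ K J ∧ ∀ u ∈ J,
    deriv K u - K u * (deriv H u / H u) = 0 ∧
    deriv (deriv K) u - deriv g u * K u - (g u * K u + deriv K u) * (deriv H u / H u)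
      + K u * (3 * deriv g u - 2 * g u ^ 2) = 0

/-- The data of the implicitly defined family: `h` solves `h h'' - h'² = a h' + b` on `J`, and
`h' = pᵢ(h)` there. The nonvanishing of `h'² + a h' + b` says that the coefficient
`H = σ (h'² + a h' + b) / h²` does not vanish. -/
structure IsImplicitProfile (J : Set ℝ) (a b h₀ : ℝ) (h : ℝ → ℝ) : Prop where
  a_ne : a ≠ 0
  b_ne : b ≠ 0
  h₀_ne : h₀ ≠ 0
  smooth : ContDiffOn ℝ ∞ h J
  h_ne : ∀ u ∈ J, h u ≠ 0
  quad_ne : ∀ u ∈ J, deriv h u ^ 2 + a * deriv h u + b ≠ 0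
  ode : ∀ u ∈ J, h u * deriv (deriv h) u - deriv h u ^ 2 = a * deriv h u + b
  implicit : ∀ u ∈ J, ImplicitRelation a b h₀ (h u) (deriv h u)

/-- The list of normal forms: the equation with coefficients `H, K` on the interval `J`, together
with the function `q` of its separable solution `q(u) = φ(t) + ψ(x)`. -/
inductive IsListed (J : Set ℝ) (H K q : ℝ → ℝ) : Prop
  | a (σ ε : ℝ) (hσ : σ = 1 ∨ σ = -1) (hε : ε = 0 ∨ ε = 1)
      (hH : EqOn H (fun u => σ * Real.exp u) J)
      (hK : EqOn K (fun u => σ * (ε * Real.exp u)) J)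
      (hq : EqOn q (fun u => u) J)
  | b (σ ε μ : ℝ) (hσ : σ = 1 ∨ σ = -1) (hε : ε = 0 ∨ ε = 1) (hμ : μ ≠ 0)
      (hJ : ∀ u ∈ J, 0 < u)
      (hH : EqOn H (fun u => σ * u ^ μ) J)
      (hK : EqOn K (fun u => σ * (ε * u ^ μ)) J)
      (hq : EqOn q (fun u => Real.log u) J)
  | c (hJ : ∀ u ∈ J, u ≠ 0)
      (hH : EqOn H (fun u => (Real.exp u - 1)⁻¹) J)
      (hK : EqOn K (fun _ => 0) J)
      (hq : EqOn q (fun u => Real.log |Real.exp u - 1|) J)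
  | d (σ : ℝ) (hσ : σ = 1 ∨ σ = -1)
      (hH : EqOn H (fun u => σ * (Real.exp u * (Real.exp u + 1)⁻¹)) J)
      (hK : EqOn K (fun _ => 0) J)
      (hq : EqOn q (fun u => u - Real.log (Real.exp u + 1)) J)
  | e (hJ : ∀ u ∈ J, u ≠ 0)
      (hH : EqOn H (fun u => Real.exp u * (Real.exp u - 1)⁻¹) J)
      (hK : EqOn K (fun _ => 0) J)
      (hq : EqOn q (fun u => -u + Real.log |Real.exp u - 1|) J)
  | f (σ : ℝ) (hσ : σ = 1 ∨ σ = -1)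
      (hH : EqOn H (fun u => σ * (Real.exp u + 1)⁻¹) J)
      (hK : EqOn K (fun _ => 0) J)
      (hq : EqOn q (fun u => Real.log (Real.exp u + 1)) J)
  | g (σ a b h₀ : ℝ) (h : ℝ → ℝ) (hσ : σ = 1 ∨ σ = -1)
      (hh : IsImplicitProfile J a b h₀ h)
      (hH : EqOn H (fun u => σ * ((deriv h u ^ 2 + a * deriv h u + b) / h u ^ 2)) J)
      (hK : KEquations J H K (fun u => -deriv h u / h u))
      (hq : ∀ u ∈ J, HasDerivAt q (1 / h u) u)

/-! Put `h = 1/q'`, `P = φ'`, `S = ψ'`. Then `u_t = h P`, `u_x = h S`, and division of the equation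
by `h` leaves the separated equation `P' + h' P² = H S' + (h H' + H h') S² + K S`. Compatibility of
the ansatz is equivalent to four conditions on the coefficients, collected in `SeparationODE`: `h H'
= k H`, `h h'' = h'² + k h' + d`, `K = c H`, `c h'' = 0`.

Necessity: cross-differentiating the separated equation and eliminating `P'`, `P''`, `S''` gives a
polynomial identity in the values of `P`, `S`, `S'` at a point (`separated_consequence`).
Compatibility makes these values arbitrary, with `P ≠ 0`, so coefficients can be compared, and the
resulting relations integrate to the four conditions.

Sufficiency: solve the separated equation as an ODE for `u` along each of the two coordinate lines
through the given point, and glue by `q(u) = φ + ψ`. The defect `E` of the separated equation then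
vanishes on both lines and, because of the four conditions, satisfies a linear equation `E_xt = α
E_x + β E`; Goursat uniqueness gives `E = 0` nearby (`separated_of_characteristics`).

Classification: nonlinearity means `k ≠ 0`. Both `h h''` and `H h²` solve `h y' = (2h' + k) y`, so
`h h'' = C H h²`. If `C = 0`, then `h` is affine, which gives (a) and (b). If `C ≠ 0`, then `h''`
never vanishes and `K = 0`; `d = 0` makes `h` a constant plus an exponential, giving (c), (d), (e),
and `d ≠ 0` gives (g), whose implicit relation is a first integral of the equation for `h`. Form (f)
is (d) after `u ↦ -u`, so the classification never needs to produce it. -/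

/-- The ordinary differential equations that characterize compatibility of the ansatz
`q(u) = φ(t) + ψ(x)`, written with `h = 1 / q'` and its first two derivatives `h₁`, `h₂`. -/
structure SeparationODE (I : Set ℝ) (H K q h h₁ h₂ : ℝ → ℝ) (k d c : ℝ) : Prop where
  smooth : ContDiffOn ℝ ∞ h I
  ne_zero : ∀ u ∈ I, h u ≠ 0
  hasDerivAt_q : ∀ u ∈ I, HasDerivAt q (1 / h u) u
  hasDerivAt_h : ∀ u ∈ I, HasDerivAt h (h₁ u) u
  hasDerivAt_h₁ : ∀ u ∈ I, HasDerivAt h₁ (h₂ u) u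
  hasDerivAt_H : ∀ u ∈ I, HasDerivAt H (k * H u / h u) u
  quad : ∀ u ∈ I, h u * h₂ u = h₁ u ^ 2 + k * h₁ u + d
  K_eq : ∀ u ∈ I, K u = c * H u
  degenerate : ∀ u ∈ I, c * h₂ u = 0

/-- Some functions and constants satisfy `SeparationODE`. -/
def SeparationCriterion (I : Set ℝ) (H K q : ℝ → ℝ) : Prop :=
  ∃ (h h₁ h₂ : ℝ → ℝ) (k d c : ℝ), SeparationODE I H K q h h₁ h₂ k d c

/-! ### Invariance of the criterion under equivalence transformations. -/

namespace EquivTransformation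

lemma hasDerivAt_onU (τ : EquivTransformation) (u : ℝ) : HasDerivAt τ.onU τ.e₆ u := by
  have := ((hasDerivAt_id u).const_mul τ.e₆).add_const τ.e₃
  rw [mul_one] at this
  exact this

lemma isOpen_image (τ : EquivTransformation) {I : Set ℝ} (hI : IsOpen I) :
    IsOpen (τ.onU '' I) := by
  have : τ.onU '' I = (fun y => (y - τ.e₃) / τ.e₆) ⁻¹' I := by
    ext y
    constructor
    · rintro ⟨u, hu, rfl⟩
      have : (τ.onU u - τ.e₃) / τ.e₆ = u := by
        have := τ.e₆_ne
        simp only [EquivTransformation.onU]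
        field_simp
        ring
      simpa [this] using hu
    · intro hy
      refine ⟨_, hy, ?_⟩
      have := τ.e₆_ne
      simp only [EquivTransformation.onU]
      field_simp
      ring
  rw [this]
  exact hI.preimage (by fun_prop)

end EquivTransformation

/-- Since `q' = α e₆ (q̃' ∘ τ)`, the profile `h` is divided by `α e₆`, and each `u`-derivative
brings back a factor `e₆`. This dictates the rescaling of `k` and `d`; the ratio `c = K/H` only sees
`e₅`. -/
lemma SeparationCriterion.of_carries {τ : EquivTransformation} {I J : Set ℝ}
    {H K H' K' q q' : ℝ → ℝ} (hI : IsOpen I) (hτ : τ.Carries I H K J H' K')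
    {α β : ℝ} (hα : α ≠ 0) (hq : ∀ u ∈ I, q u = α * q' (τ.onU u) + β)
    (hc : SeparationCriterion J H' K' q') : SeparationCriterion I H K q := by
  obtain ⟨h, h₁, h₂, k, d, c, S⟩ := hc
  obtain ⟨hJ, hHK⟩ := hτ
  have hmem : ∀ u ∈ I, τ.onU u ∈ J := fun u hu => hJ ▸ mem_image_of_mem _ hu
  have h4 := τ.e₄_ne
  have h5 := τ.e₅_ne
  have h6 := τ.e₆_ne
  have comp : ∀ {f : ℝ → ℝ} {f' u : ℝ}, HasDerivAt f f' (τ.onU u) →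
      HasDerivAt (fun v => f (τ.onU v)) (f' * τ.e₆) u := fun hf =>
    hf.comp _ (τ.hasDerivAt_onU _)
  have hH : ∀ u ∈ I, H u = H' (τ.onU u) * (τ.e₄ ^ 2 / τ.e₅ ^ 2) := by
    intro u hu
    rw [(hHK u hu).1]
    field_simp
  have hK : ∀ u ∈ I, K u = K' (τ.onU u) * (τ.e₄ ^ 2 / τ.e₅) := by
    intro u hu
    rw [(hHK u hu).2]
    field_simp
  refine ⟨fun u => h (τ.onU u) / (α * τ.e₆), fun u => h₁ (τ.onU u) / α,
    fun u => h₂ (τ.onU u) * τ.e₆ / α, k / α, d / α ^ 2, c * τ.e₅, ?_, ?_, ?_, ?_, ?_, ?_, ?_, ?_, ?_⟩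
  · refine ContDiffOn.div_const ?_ _
    refine S.smooth.comp ?_ hmem
    unfold EquivTransformation.onU
    fun_prop
  · intro u hu
    have := S.ne_zero _ (hmem u hu)
    positivity
  · intro u hu
    have hne := S.ne_zero _ (hmem u hu)
    have := ((comp (S.hasDerivAt_q _ (hmem u hu))).const_mul α).add_const β
    refine (this.congr_of_eventuallyEq ?_).congr_deriv ?_
    · filter_upwards [hI.mem_nhds hu] with v hv using hq v hv
    · field_simp
  · intro u hu
    refine ((comp (S.hasDerivAt_h _ (hmem u hu))).div_const _).congr_deriv ?_
    field_simp
  · intro u hu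
    exact (comp (S.hasDerivAt_h₁ _ (hmem u hu))).div_const _
  · intro u hu
    have hne := S.ne_zero _ (hmem u hu)
    refine (((comp (S.hasDerivAt_H _ (hmem u hu))).mul_const
      (τ.e₄ ^ 2 / τ.e₅ ^ 2)).congr_of_eventuallyEq ?_).congr_deriv ?_
    · filter_upwards [hI.mem_nhds hu] with v hv using hH v hv
    · rw [hH u hu]
      field_simp
  · intro u hu
    have := S.quad _ (hmem u hu)
    field_simp
    linear_combination this
  · intro u hu
    rw [hK u hu, hH u hu, S.K_eq _ (hmem u hu)]
    field_simp
  · intro u hu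
    have := S.degenerate _ (hmem u hu)
    linear_combination τ.e₅ * τ.e₆ / α * this

/-! ### The listed equations satisfy the criterion. -/

/-- `SeparationODE` depends only on the values of `H`, `K`, `q` on the open set. -/
lemma SeparationODE.congr {I : Set ℝ} (hI : IsOpen I) {H K q H' K' q' h h₁ h₂ : ℝ → ℝ}
    {k d c : ℝ} (S : SeparationODE I H' K' q' h h₁ h₂ k d c) (hH : EqOn H H' I)
    (hK : EqOn K K' I) (hq : EqOn q q' I) : SeparationODE I H K q h h₁ h₂ k d c where
  smooth := S.smooth
  ne_zero := S.ne_zero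
  hasDerivAt_q u hu := (S.hasDerivAt_q u hu).congr_of_eventuallyEq
    (Filter.eventuallyEq_of_mem (hI.mem_nhds hu) hq)
  hasDerivAt_h := S.hasDerivAt_h
  hasDerivAt_h₁ := S.hasDerivAt_h₁
  hasDerivAt_H u hu := by
    rw [hH hu]
    exact (S.hasDerivAt_H u hu).congr_of_eventuallyEq
      (Filter.eventuallyEq_of_mem (hI.mem_nhds hu) hH)
  quad := S.quad
  K_eq u hu := by rw [hK hu, hH hu, S.K_eq u hu]
  degenerate := S.degenerate

lemma exp_sub_one_ne_zero {u : ℝ} (hu : u ≠ 0) : Real.exp u - 1 ≠ 0 := by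
  rw [sub_ne_zero]
  simpa using hu

lemma hasDerivAt_log_abs_exp_sub_one {u : ℝ} (hu : u ≠ 0) :
    HasDerivAt (fun v => Real.log |Real.exp v - 1|) (Real.exp u / (Real.exp u - 1)) u := by
  simp only [Real.log_abs]
  exact ((Real.hasDerivAt_exp u).sub_const 1).log (exp_sub_one_ne_zero hu)

/-- An implicit profile satisfies `SeparationODE`; its equations for `K` force `K = 0`. -/
lemma SeparationODE.of_isImplicitProfile {J : Set ℝ} (hJ : IsOpen J) {H K q h : ℝ → ℝ}
    {σ a b h₀ : ℝ} (hσ : σ = 1 ∨ σ = -1) (hh : IsImplicitProfile J a b h₀ h)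
    (hH : EqOn H (fun u => σ * ((deriv h u ^ 2 + a * deriv h u + b) / h u ^ 2)) J)
    (hK : KEquations J H K (fun u => -deriv h u / h u))
    (hq : ∀ u ∈ J, HasDerivAt q (1 / h u) u) :
    SeparationODE J H K q h (deriv h) (deriv (deriv h)) a b 0 := by
  have hσ0 : σ ≠ 0 := by rcases hσ with rfl | rfl <;> norm_num
  have hd1 : ContDiffOn ℝ ∞ (deriv h) J := ((contDiffOn_infty_iff_deriv_of_isOpen hJ).1 hh.smooth).2
  have D : ∀ u ∈ J, HasDerivAt h (deriv h u) u := fun u hu =>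
    ((hh.smooth.differentiableOn (by simp)).differentiableAt (hJ.mem_nhds hu)).hasDerivAt
  have D1 : ∀ u ∈ J, HasDerivAt (deriv h) (deriv (deriv h) u) u := fun u hu =>
    ((hd1.differentiableOn (by simp)).differentiableAt (hJ.mem_nhds hu)).hasDerivAt
  have DH : ∀ u ∈ J, HasDerivAt H (a * H u / h u) u := by
    intro u hu
    have hne := hh.h_ne u hu
    have e := hh.ode u hu
    have := ((((D1 u hu).pow 2).add ((D1 u hu).const_mul a)).add_const b).div ((D u hu).pow 2)
      (pow_ne_zero 2 hne) |>.const_mul σ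
    refine (this.congr_of_eventuallyEq
      (Filter.eventuallyEq_of_mem (hJ.mem_nhds hu) hH)).congr_deriv ?_
    rw [hH hu]
    have e' : deriv (deriv h) u = (deriv h u ^ 2 + a * deriv h u + b) / h u := by
      field_simp
      linear_combination e
    simp only [e', Pi.add_apply, Pi.pow_apply]
    field_simp
    ring
  have Hne : ∀ u ∈ J, H u ≠ 0 := by
    intro u hu
    rw [hH hu]
    exact mul_ne_zero hσ0 (div_ne_zero (hh.quad_ne u hu) (pow_ne_zero 2 (hh.h_ne u hu)))
  have hrat : ∀ u ∈ J, deriv H u / H u = a / h u := by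
    intro u hu
    rw [(DH u hu).deriv]
    have := Hne u hu
    have := hh.h_ne u hu
    field_simp
  have DK : ∀ u ∈ J, HasDerivAt K (K u * (a / h u)) u := by
    intro u hu
    have h1 := (hK.2 u hu).1
    rw [hrat u hu] at h1
    rw [← sub_eq_zero.1 h1]
    exact ((hK.1.differentiableOn (by simp)).differentiableAt (hJ.mem_nhds hu)).hasDerivAt
  have K0 : ∀ u ∈ J, K u = 0 := by
    intro u hu
    have hne := hh.h_ne u hu
    have e := hh.ode u hu
    have h2 := (hK.2 u hu).2
    have h3 : deriv (deriv K) u = K u * (a / h u) * (a / h u) - K u * (a * deriv h u / h u ^ 2) := by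
      have : deriv K =ᶠ[nhds u] fun v => K v * (a / h v) := by
        filter_upwards [hJ.mem_nhds hu] with v hv using (DK v hv).deriv
      rw [this.deriv_eq]
      have := (DK u hu).mul ((hasDerivAt_const u a).div (D u hu) hne)
      rw [HasDerivAt.deriv (f := fun v => K v * (a / h v)) this]
      simp only [Pi.div_apply]
      field_simp
      ring
    have h4 : deriv (fun u => -deriv h u / h u) u
        = -deriv (deriv h) u / h u + deriv h u ^ 2 / h u ^ 2 := by
      have := (D1 u hu).neg.div (D u hu) hne
      rw [HasDerivAt.deriv (f := fun u => -deriv h u / h u) this]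
      simp only [Pi.neg_apply]
      field_simp
      ring
    rw [h3, h4, hrat u hu, (DK u hu).deriv] at h2
    have e' : deriv (deriv h) u = (deriv h u ^ 2 + a * deriv h u + b) / h u := by
      field_simp
      linear_combination e
    rw [e'] at h2
    -- With `H'/H = a/h` and `K' = a K/h`, everything in the second equation for `K` cancels except
    -- `-2 K (h'² + a h' + b)/h²`.
    have h5 : K u * (deriv h u ^ 2 + a * deriv h u + b) = 0 := by
      field_simp at h2
      linear_combination (-1 / 2) * h2
    exact (mul_eq_zero.1 h5).resolve_right (hh.quad_ne u hu)
  exact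
    { smooth := hh.smooth
      ne_zero := hh.h_ne
      hasDerivAt_q := hq
      hasDerivAt_h := D
      hasDerivAt_h₁ := D1
      hasDerivAt_H := DH
      quad := fun u hu => by linear_combination hh.ode u hu
      K_eq := fun u hu => by rw [K0 u hu, zero_mul]
      degenerate := fun u hu => zero_mul _ }

/-- In each case `h = 1/q'` and `k = h H'/H` are read off from the listed formulas, and `d` is what
remains of `h h'' - h'² - k h'`. -/
lemma IsListed.separationCriterion {J : Set ℝ} (hJo : IsOpen J) {H K q : ℝ → ℝ}
    (hL : IsListed J H K q) : SeparationCriterion J H K q := by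
  have E : ∀ u : ℝ, HasDerivAt Real.exp (Real.exp u) u := Real.hasDerivAt_exp
  have EN : ∀ u : ℝ, HasDerivAt (fun v => Real.exp (-v)) (-Real.exp (-u)) u := fun u => by
    simpa using (hasDerivAt_neg u).exp
  cases hL with
  | a σ ε hσ hε hH hK hq =>
    refine ⟨fun _ => 1, fun _ => 0, fun _ => 0, 1, 0, ε, SeparationODE.congr hJo ?_ hH hK hq⟩
    refine ⟨by fun_prop, by simp, fun u _ => by simpa using! hasDerivAt_id u,
      fun u _ => hasDerivAt_const _ _, fun u _ => hasDerivAt_const _ _,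
      fun u _ => by simpa using (E u).const_mul σ, by simp, fun u _ => by ring, by simp⟩
  | b σ ε μ hσ hε hμ hJ hH hK hq =>
    refine ⟨fun u => u, fun _ => 1, fun _ => 0, μ, -1 - μ, ε,
      SeparationODE.congr hJo ?_ hH hK hq⟩
    refine ⟨by fun_prop, fun u hu => (hJ u hu).ne',
      fun u hu => by simpa using Real.hasDerivAt_log (hJ u hu).ne',
      fun u _ => hasDerivAt_id _, fun u _ => hasDerivAt_const _ _,
      fun u hu => ?_, fun u _ => by ring, fun u _ => by ring, by simp⟩
    have := (Real.hasDerivAt_rpow_const (p := μ) (Or.inl (hJ u hu).ne')).const_mul σ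
    refine this.congr_deriv ?_
    rw [Real.rpow_sub_one (hJ u hu).ne']
    ring
  | c hJ hH hK hq =>
    refine ⟨fun u => 1 - Real.exp (-u), fun u => Real.exp (-u), fun u => -Real.exp (-u), -1, 0, 0,
      SeparationODE.congr hJo ?_ hH hK hq⟩
    have hx : ∀ u : ℝ, Real.exp (-u) = 1 / Real.exp u := fun u => by rw [Real.exp_neg, one_div]
    have hne : ∀ u ∈ J, 1 - Real.exp (-u) ≠ 0 := fun u hu => by
      have := exp_sub_one_ne_zero (neg_ne_zero.2 (hJ u hu))
      contrapose! this
      linarith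
    refine ⟨by fun_prop, hne, fun u hu => ?_, fun u _ => by simpa using! (EN u).const_sub 1,
      fun u _ => EN u, fun u hu => ?_, fun u _ => by ring, by simp, by simp⟩
    · refine (hasDerivAt_log_abs_exp_sub_one (hJ u hu)).congr_deriv ?_
      have h1 := exp_sub_one_ne_zero (hJ u hu)
      have h2 := hne u hu
      have h3 := (Real.exp_pos u).ne'
      rw [hx] at h2 ⊢
      have h4 : 1 - 1 / Real.exp u = (Real.exp u - 1) / Real.exp u := by field_simp
      rw [h4]
      field_simp
    · refine (((E u).sub_const 1).inv (exp_sub_one_ne_zero (hJ u hu))).congr_deriv ?_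
      have h1 := exp_sub_one_ne_zero (hJ u hu)
      have h3 := (Real.exp_pos u).ne'
      rw [hx]
      have h4 : 1 - 1 / Real.exp u = (Real.exp u - 1) / Real.exp u := by field_simp
      rw [h4]
      field_simp
  | d σ hσ hH hK hq =>
    refine ⟨fun u => 1 + Real.exp u, Real.exp, Real.exp, 1, 0, 0,
      SeparationODE.congr hJo ?_ hH hK hq⟩
    have hp : ∀ u : ℝ, 0 < Real.exp u + 1 := fun u => by positivity
    refine ⟨by fun_prop, fun u _ => by positivity, fun u _ => ?_,
      fun u _ => by simpa using! (E u).const_add 1, fun u _ => E u, fun u _ => ?_,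
      fun u _ => by ring, by simp, by simp⟩
    · refine ((hasDerivAt_id u).sub (((E u).add_const 1).log (hp u).ne')).congr_deriv ?_
      have := (hp u).ne'
      rw [add_comm 1]
      field_simp
      ring
    · refine (((E u).mul (((E u).add_const 1).inv (hp u).ne')).const_mul σ).congr_deriv ?_
      have := (hp u).ne'
      rw [add_comm 1]
      simp only [Pi.inv_apply]
      field_simp
      ring
  | e hJ hH hK hq =>
    refine ⟨fun u => Real.exp u - 1, Real.exp, Real.exp, -1, 0, 0,
      SeparationODE.congr hJo ?_ hH hK hq⟩
    refine ⟨by fun_prop, fun u hu => exp_sub_one_ne_zero (hJ u hu), fun u hu => ?_,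
      fun u _ => by simpa using! (E u).sub_const 1, fun u _ => E u, fun u hu => ?_,
      fun u _ => by ring, by simp, by simp⟩
    · refine ((hasDerivAt_neg u).add (hasDerivAt_log_abs_exp_sub_one (hJ u hu))).congr_deriv ?_
      have := exp_sub_one_ne_zero (hJ u hu)
      field_simp
      ring
    · have h1 := exp_sub_one_ne_zero (hJ u hu)
      refine ((E u).mul (((E u).sub_const 1).inv h1)).congr_deriv ?_
      simp only [Pi.inv_apply]
      field_simp
      ring
  | f σ hσ hH hK hq =>
    refine ⟨fun u => 1 + Real.exp (-u), fun u => -Real.exp (-u), fun u => Real.exp (-u), -1, 0, 0,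
      SeparationODE.congr hJo ?_ hH hK hq⟩
    have hp : ∀ u : ℝ, 0 < Real.exp u + 1 := fun u => by positivity
    have h4 : ∀ u : ℝ, 1 + Real.exp (-u) = (Real.exp u + 1) / Real.exp u := fun u => by
      rw [Real.exp_neg]
      field_simp
    refine ⟨by fun_prop, fun u _ => by positivity, fun u _ => ?_,
      fun u _ => by simpa using! (EN u).const_add 1, fun u _ => by simpa using! (EN u).neg,
      fun u _ => ?_, fun u _ => by ring, by simp, by simp⟩
    · refine (((E u).add_const 1).log (hp u).ne').congr_deriv ?_
      rw [h4, one_div_div]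
    · refine ((((E u).add_const 1).inv (hp u).ne').const_mul σ).congr_deriv ?_
      have := (hp u).ne'
      rw [h4]
      field_simp
  | g σ a b h₀ h hσ hh hH hK hq =>
    exact ⟨_, _, _, _, _, _, SeparationODE.of_isImplicitProfile hJo hσ hh hH hK hq⟩

/-! ### Integration of linear first-order equations on an interval. -/

section Constancy

variable {I : Set ℝ} (hI : IsOpen I) (hI' : I.OrdConnected)
include hI hI'

lemma exists_eq_const_of_hasDerivAt_zero {f : ℝ → ℝ} (hf : ∀ u ∈ I, HasDerivAt f 0 u) :
    ∃ a, ∀ u ∈ I, f u = a :=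
  hI.exists_is_const_of_deriv_eq_zero hI'.isPreconnected
    (fun u hu => (hf u hu).differentiableAt.differentiableWithinAt) fun u hu => (hf u hu).deriv

lemma exists_eq_add_const_of_hasDerivAt {f g r : ℝ → ℝ} (hf : ∀ u ∈ I, HasDerivAt f (r u) u)
    (hg : ∀ u ∈ I, HasDerivAt g (r u) u) : ∃ a, ∀ u ∈ I, f u = g u + a := by
  obtain ⟨a, ha⟩ := exists_eq_const_of_hasDerivAt_zero hI hI' (f := f - g) fun u hu => by
    simpa using (hf u hu).sub (hg u hu)
  exact ⟨a, fun u hu => by simpa [sub_eq_iff_eq_add'] using ha u hu⟩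

/-- Two solutions of `y' = r y` are proportional. -/
lemma exists_eq_const_mul_of_hasDerivAt {f g r : ℝ → ℝ} (hg0 : ∀ u ∈ I, g u ≠ 0)
    (hf : ∀ u ∈ I, HasDerivAt f (r u * f u) u) (hg : ∀ u ∈ I, HasDerivAt g (r u * g u) u) :
    ∃ a, ∀ u ∈ I, f u = a * g u := by
  obtain ⟨a, ha⟩ := exists_eq_const_of_hasDerivAt_zero hI hI' (f := f / g) fun u hu => by
    refine ((hf u hu).div (hg u hu) (hg0 u hu)).congr_deriv ?_
    ring
  refine ⟨a, fun u hu => ?_⟩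
  have := ha u hu
  rwa [Pi.div_apply, div_eq_iff (hg0 u hu)] at this

omit hI in
lemma pos_or_neg_of_continuousOn {f : ℝ → ℝ} (hf : ContinuousOn f I) (h0 : ∀ u ∈ I, f u ≠ 0) :
    (∀ u ∈ I, 0 < f u) ∨ ∀ u ∈ I, f u < 0 := by
  by_contra! hcon
  obtain ⟨⟨x, hx, hfx⟩, y, hy, hfy⟩ := hcon
  obtain ⟨z, hz, hfz⟩ := hI'.isPreconnected.intermediate_value hx hy hf ⟨hfx, hfy⟩
  exact h0 z hz hfz

end Constancy

/-- Rescaling of `t` and `x` normalizes the constant factor of `H` and the ratio `K / H`. -/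
lemma exists_carries_isListed {I : Set ℝ} {H K q F q' : ℝ → ℝ} {e₃ e₆ c₀ c α β : ℝ}
    (he₆ : e₆ ≠ 0) (hc₀ : c₀ ≠ 0) (hα : α ≠ 0)
    (hH : ∀ u ∈ I, H u = c₀ * F (e₆ * u + e₃)) (hK : ∀ u ∈ I, K u = c * H u)
    (hq : ∀ u ∈ I, q u = α * q' (e₆ * u + e₃) + β)
    (hL : ∀ σ ε : ℝ, (σ = 1 ∨ σ = -1) → (ε = 0 ∨ ε = 1) → 0 < σ * c₀ → (c = 0 → ε = 0) →
      IsListed ((fun u => e₆ * u + e₃) '' I) (fun u => σ * F u) (fun u => σ * (ε * F u)) q') :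
    ∃ (τ : EquivTransformation) (J : Set ℝ) (H' K' q' : ℝ → ℝ),
      τ.Carries I H K J H' K' ∧ IsListed J H' K' q' ∧
      ∃ α β : ℝ, α ≠ 0 ∧ ∀ u ∈ I, q u = α * q' (τ.onU u) + β := by
  obtain ⟨ε, e₅, hε, he₅, hce, hc⟩ : ∃ ε e₅ : ℝ, (ε = 0 ∨ ε = 1) ∧ e₅ ≠ 0 ∧ c = ε * e₅ ∧
      (c = 0 → ε = 0) := by
    by_cases h : c = 0
    · exact ⟨0, 1, by simp, by simp, by simp [h], by simp⟩
    · exact ⟨1, c, by simp, h, by simp, fun h' => absurd h' h⟩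
  obtain ⟨σ, hσ, hσc⟩ : ∃ σ : ℝ, (σ = 1 ∨ σ = -1) ∧ 0 < σ * c₀ := by
    rcases hc₀.lt_or_gt with h | h
    · exact ⟨-1, by simp, by linarith⟩
    · exact ⟨1, by simp, by linarith⟩
  have hσ2 : σ ^ 2 = 1 := by rcases hσ with rfl | rfl <;> norm_num
  have hs : √(σ * c₀) ^ 2 = σ * c₀ := Real.sq_sqrt hσc.le
  have hs0 : √(σ * c₀) ≠ 0 := (Real.sqrt_pos.2 hσc).ne'
  have hσ0 : σ ≠ 0 := by rcases hσ with rfl | rfl <;> norm_num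
  -- Here `e₄² = e₅² σ c₀`, so `H` is divided by `σ c₀`, which turns `c₀ F` into `σ F`, while `K/H =
  -- c` is divided by `e₅` and becomes `ε`.
  refine ⟨⟨0, 0, e₃, e₅ * √(σ * c₀), e₅, e₆, mul_ne_zero he₅ hs0, he₅, he₆⟩, _, _, _, q',
    ⟨rfl, fun u hu => ?_⟩, hL σ ε hσ hε hσc hc, α, β, hα, hq⟩
  simp only [EquivTransformation.onU, mul_pow, hs]
  rw [hK u hu, hce, hH u hu]
  constructor
  · field_simp
    linear_combination F (e₆ * u + e₃) * hσ2
  · field_simp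
    linear_combination ε * F (e₆ * u + e₃) * hσ2

/-! ### First integrals of `h h'' = h'² + a h' + b`. -/

section Profile

variable {I : Set ℝ} (hI : IsOpen I) (hI' : I.OrdConnected) (hne : I.Nonempty) {h h₁ h₂ : ℝ → ℝ}
  {a b : ℝ} (h_ne : ∀ u ∈ I, h u ≠ 0) (D : ∀ u ∈ I, HasDerivAt h (h₁ u) u)
  (D₁ : ∀ u ∈ I, HasDerivAt h₁ (h₂ u) u) (quad : ∀ u ∈ I, h u * h₂ u = h₁ u ^ 2 + a * h₁ u + b)
  (quad_ne : ∀ u ∈ I, h₁ u ^ 2 + a * h₁ u + b ≠ 0)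
include hI hI' hne h_ne D D₁ quad quad_ne

/-- With `p = h'` the equation reads `dh/h = p dp/(p² + a p + b)`, and the sign of the discriminant
decides the form of the integral. Here the denominator is `(p + a/2)²`, and the left side below has
logarithmic derivative `h'/h`, as `h` does. -/
lemma exists_firstIntegral_of_discrim_eq_zero (hΔ : a ^ 2 - 4 * b = 0) :
    ∃ h₀ : ℝ, h₀ ≠ 0 ∧ ∀ u ∈ I,
      (h₁ u + a / 2) * Real.exp (a / (2 * h₁ u + a)) = h u / h₀ := by
  have hy : ∀ u ∈ I, 2 * h₁ u + a ≠ 0 := fun u hu h0 => quad_ne u hu (by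
    linear_combination (2 * h₁ u + a) / 4 * h0 - hΔ / 4)
  obtain ⟨C, hC⟩ := exists_eq_const_mul_of_hasDerivAt hI hI'
    (f := fun u => (h₁ u + a / 2) * Real.exp (a / (2 * h₁ u + a))) (g := h)
    (r := fun u => h₁ u / h u) h_ne (fun u hu => by
      have h1 := ((D₁ u hu).const_mul 2).add_const a
      have h2 := (((hasDerivAt_const u a).div h1 (hy u hu)).exp)
      refine (((D₁ u hu).add_const (a / 2)).mul h2).congr_deriv ?_
      have e : h₂ u = (2 * h₁ u + a) ^ 2 / 4 / h u := by
        have := h_ne u hu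
        field_simp
        linear_combination 4 * quad u hu - hΔ
      have := hy u hu
      have := h_ne u hu
      simp only [Pi.div_apply, e]
      field_simp
      ring) (fun u hu => by
      refine (D u hu).congr_deriv ?_
      have := h_ne u hu
      field_simp)
  have hC0 : C ≠ 0 := by
    obtain ⟨u, hu⟩ := hne
    rintro rfl
    have h1 := hC u hu
    rw [zero_mul] at h1
    have h2 := (mul_eq_zero.1 h1).resolve_right (Real.exp_pos _).ne'
    exact hy u hu (by linarith)
  exact ⟨C⁻¹, inv_ne_zero hC0, fun u hu => by rw [hC u hu]; field_simp⟩

-- Partial fractions: with `r = √Δ`, the residues of `2r p/(p² + a p + b)` at its two roots are `r +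
-- a` and `r - a`, which explains the exponents.
omit hne in
lemma exists_firstIntegral_of_discrim_pos (hΔ : 0 < a ^ 2 - 4 * b) :
    ∃ h₀ : ℝ, h₀ ≠ 0 ∧ ∀ u ∈ I,
      |h₁ u + (a + √(a ^ 2 - 4 * b)) / 2| ^ (√(a ^ 2 - 4 * b) + a)
        * |h₁ u + (a - √(a ^ 2 - 4 * b)) / 2| ^ (√(a ^ 2 - 4 * b) - a)
        = |h u / h₀| ^ (2 * √(a ^ 2 - 4 * b)) := by
  have hr2 : √(a ^ 2 - 4 * b) ^ 2 = a ^ 2 - 4 * b := Real.sq_sqrt hΔ.le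
  have hr : 0 < √(a ^ 2 - 4 * b) := Real.sqrt_pos.2 hΔ
  generalize √(a ^ 2 - 4 * b) = r at hr2 hr
  have hfac : ∀ u, h₁ u ^ 2 + a * h₁ u + b = (h₁ u + (a + r) / 2) * (h₁ u + (a - r) / 2) := by
    intro u
    linear_combination hr2 / 4
  have hy : ∀ u ∈ I, h₁ u + (a + r) / 2 ≠ 0 ∧ h₁ u + (a - r) / 2 ≠ 0 := fun u hu => by
    have := quad_ne u hu
    rw [hfac] at this
    exact ⟨left_ne_zero_of_mul this, right_ne_zero_of_mul this⟩
  obtain ⟨C, hC⟩ := exists_eq_add_const_of_hasDerivAt hI hI'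
    (f := fun u => Real.log (h₁ u + (a + r) / 2) * (r + a)
      + Real.log (h₁ u + (a - r) / 2) * (r - a))
    (g := fun u => Real.log (h u) * (2 * r)) (r := fun u => h₁ u / h u * (2 * r)) (fun u hu => by
      have h1 := ((D₁ u hu).add_const ((a + r) / 2)).log (hy u hu).1
      have h2 := ((D₁ u hu).add_const ((a - r) / 2)).log (hy u hu).2
      refine ((h1.mul_const (r + a)).add (h2.mul_const (r - a))).congr_deriv ?_
      have e : h₂ u = (h₁ u + (a + r) / 2) * (h₁ u + (a - r) / 2) / h u := by
        have := h_ne u hu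
        rw [← hfac]
        field_simp
        linear_combination quad u hu
      have n₁ := (hy u hu).1
      have n₂ := (hy u hu).2
      have := h_ne u hu
      rw [e]
      -- In terms of the two linear factors, `h' = (y₁ + y₂ - a)/2` and `r = y₁ - y₂`, so the claim
      -- becomes a rational identity without square roots.
      obtain ⟨y₁, hy₁⟩ : ∃ y, h₁ u + (a + r) / 2 = y := ⟨_, rfl⟩
      obtain ⟨y₂, hy₂⟩ : ∃ y, h₁ u + (a - r) / 2 = y := ⟨_, rfl⟩
      rw [hy₁] at n₁ ⊢
      rw [hy₂] at n₂ ⊢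
      have e₁ : h₁ u = (y₁ + y₂ - a) / 2 := by linarith
      have e₂ : r = y₁ - y₂ := by linarith
      rw [e₁, e₂]
      field_simp
      ring) (fun u hu => ((D u hu).log (h_ne u hu)).mul_const _)
  refine ⟨Real.exp (-C / (2 * r)), (Real.exp_pos _).ne', fun u hu => ?_⟩
  have := hC u hu
  have p1 := abs_pos.2 (hy u hu).1
  have p2 := abs_pos.2 (hy u hu).2
  have p3 := abs_pos.2 (h_ne u hu)
  rw [abs_div, abs_of_pos (Real.exp_pos _), Real.rpow_def_of_pos p1, Real.rpow_def_of_pos p2,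
    Real.rpow_def_of_pos (div_pos p3 (Real.exp_pos _)), Real.log_div p3.ne' (Real.exp_pos _).ne',
    Real.log_exp, ← Real.exp_add, Real.log_abs, Real.log_abs, Real.log_abs, this]
  congr 1
  field_simp
  ring

-- With `θ = (2p + a)/r`, the integral of `2p dp/(p² + a p + b)` is `log (1 + θ²) - (2a/r) arctan θ`
-- up to a constant, and it equals `log h²` up to a constant.
omit quad_ne in
lemma exists_firstIntegral_of_discrim_neg (hΔ : a ^ 2 - 4 * b < 0) :
    ∃ h₀ : ℝ, h₀ ≠ 0 ∧ ∀ u ∈ I,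
      (1 + ((2 * h₁ u + a) / √(-(a ^ 2 - 4 * b))) ^ 2)
        * Real.exp (-2 * (a / √(-(a ^ 2 - 4 * b)))
            * Real.arctan ((2 * h₁ u + a) / √(-(a ^ 2 - 4 * b))))
        = (h u / h₀) ^ 2 := by
  have hr2 : √(-(a ^ 2 - 4 * b)) ^ 2 = -(a ^ 2 - 4 * b) := Real.sq_sqrt (by linarith)
  have hr : 0 < √(-(a ^ 2 - 4 * b)) := Real.sqrt_pos.2 (by linarith)
  generalize √(-(a ^ 2 - 4 * b)) = r at hr2 hr
  obtain ⟨C, hC⟩ := exists_eq_const_mul_of_hasDerivAt hI hI'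
    (f := fun u => (1 + ((2 * h₁ u + a) / r) ^ 2)
      * Real.exp (-2 * (a / r) * Real.arctan ((2 * h₁ u + a) / r))) (g := fun u => h u ^ 2)
    (r := fun u => 2 * h₁ u / h u) (fun u hu => pow_ne_zero 2 (h_ne u hu)) (fun u hu => by
      have h1 := (((D₁ u hu).const_mul 2).add_const a).div_const r
      have h2 := (h1.arctan.const_mul (-2 * (a / r))).exp
      refine (((h1.pow 2).const_add 1).mul h2).congr_deriv ?_
      have e : h₂ u = r ^ 2 / 4 * (1 + ((2 * h₁ u + a) / r) ^ 2) / h u := by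
        have := h_ne u hu
        field_simp
        linear_combination 4 * quad u hu - hr2
      have h3 : 1 + ((2 * h₁ u + a) / r) ^ 2 ≠ 0 := by positivity
      have := h_ne u hu
      simp only [Pi.pow_apply, e]
      obtain ⟨θ, hθ⟩ : ∃ θ, (2 * h₁ u + a) / r = θ := ⟨_, rfl⟩
      rw [hθ] at h3 ⊢
      have e₁ : h₁ u = (r * θ - a) / 2 := by
        rw [← hθ]
        field_simp
        ring
      rw [e₁]
      field_simp
      ring) (fun u hu => by
      refine ((D u hu).pow 2).congr_deriv ?_
      have := h_ne u hu
      push_cast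
      field_simp)
  have hC0 : 0 < C := by
    obtain ⟨u, hu⟩ := hne
    have h1 := hC u hu
    have h2 : 0 < C * h u ^ 2 := by rw [← h1]; positivity
    exact pos_of_mul_pos_left h2 (by positivity)
  refine ⟨(√C)⁻¹, inv_ne_zero (Real.sqrt_pos.2 hC0).ne', fun u hu => ?_⟩
  rw [hC u hu, div_inv_eq_mul, mul_pow, Real.sq_sqrt hC0.le, mul_comm]

/-- The implicit relation is a first integral of `h h'' - h'² = a h' + b`. -/
lemma exists_implicitRelation :
    ∃ h₀ : ℝ, h₀ ≠ 0 ∧ ∀ u ∈ I, ImplicitRelation a b h₀ (h u) (h₁ u) := by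
  rcases lt_trichotomy (a ^ 2 - 4 * b) 0 with hΔ | hΔ | hΔ
  · obtain ⟨h₀, h0, hr⟩ := exists_firstIntegral_of_discrim_neg hI hI' hne h_ne D D₁ quad hΔ
    exact ⟨h₀, h0, fun u hu => ⟨fun h => absurd h hΔ.ne, fun h => absurd h hΔ.not_gt,
      fun _ => hr u hu⟩⟩
  · obtain ⟨h₀, h0, hr⟩ :=
      exists_firstIntegral_of_discrim_eq_zero hI hI' hne h_ne D D₁ quad quad_ne hΔ
    exact ⟨h₀, h0, fun u hu => ⟨fun _ => hr u hu, fun h => absurd hΔ h.ne',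
      fun h => absurd hΔ h.ne⟩⟩
  · obtain ⟨h₀, h0, hr⟩ := exists_firstIntegral_of_discrim_pos hI hI' h_ne D D₁ quad quad_ne hΔ
    exact ⟨h₀, h0, fun u hu => ⟨fun h => absurd h hΔ.ne', fun _ => hr u hu,
      fun h => absurd h hΔ.not_gt⟩⟩

end Profile

/-! ### Classification: from the ODE conditions to the normal forms. -/

/-- The conclusion of the classification: an equivalence to a listed equation whose separable
solution matches `q`. -/
def HasListedForm (I : Set ℝ) (H K q : ℝ → ℝ) : Prop :=
  ∃ (τ : EquivTransformation) (J : Set ℝ) (H' K' q' : ℝ → ℝ),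
    τ.Carries I H K J H' K' ∧ IsListed J H' K' q' ∧
    ∃ α β : ℝ, α ≠ 0 ∧ ∀ u ∈ I, q u = α * q' (τ.onU u) + β

namespace SeparationODE

variable {I : Set ℝ} (hI : IsOpen I) (hI' : I.OrdConnected) (hne : I.Nonempty)
  {H K q h h₁ h₂ : ℝ → ℝ} {k d c : ℝ} (S : SeparationODE I H K q h h₁ h₂ k d c)
  (hH_ne : ∀ u ∈ I, H u ≠ 0)

include S

lemma hasDerivAt_H' {u : ℝ} (hu : u ∈ I) : HasDerivAt H (k / h u * H u) u :=
  (S.hasDerivAt_H u hu).congr_deriv (by ring)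

include hI hI'

/-- `h h''` is a constant multiple of `H h²`. -/
lemma exists_h₂_eq (hH_ne : ∀ u ∈ I, H u ≠ 0) :
    ∃ C, ∀ u ∈ I, h u * h₂ u = C * (H u * h u ^ 2) := by
  obtain ⟨C, hC⟩ := exists_eq_const_mul_of_hasDerivAt hI hI'
    (f := fun u => h₁ u ^ 2 + k * h₁ u + d) (g := fun u => H u * h u ^ 2)
    (r := fun u => (2 * h₁ u + k) / h u)
    (fun u hu => mul_ne_zero (hH_ne u hu) (pow_ne_zero 2 (S.ne_zero u hu)))
    (fun u hu => by
      refine (((S.hasDerivAt_h₁ u hu).pow 2).add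
        ((S.hasDerivAt_h₁ u hu).const_mul k)).add_const d |>.congr_deriv ?_
      rw [← S.quad u hu]
      have := S.ne_zero u hu
      push_cast
      field_simp)
    (fun u hu => by
      refine ((S.hasDerivAt_H u hu).mul ((S.hasDerivAt_h u hu).pow 2)).congr_deriv ?_
      have := S.ne_zero u hu
      simp only [Pi.pow_apply]
      push_cast
      field_simp
      ring)
  exact ⟨C, fun u hu => by rw [S.quad u hu, hC u hu]⟩

include hne hH_ne

/-- Reduces the identification of `H` in the explicit cases to checking that the proposed `F` solves
the same linear equation. -/
lemma exists_factor {F : ℝ → ℝ} (hF0 : ∀ u ∈ I, F u ≠ 0)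
    (hF : ∀ u ∈ I, HasDerivAt F (k / h u * F u) u) : ∃ c₀, c₀ ≠ 0 ∧ ∀ u ∈ I, H u = c₀ * F u := by
  obtain ⟨c₀, hc⟩ := exists_eq_const_mul_of_hasDerivAt hI hI' hF0
    (fun u hu => S.hasDerivAt_H' hu) hF
  refine ⟨c₀, ?_, hc⟩
  rintro rfl
  obtain ⟨u, hu⟩ := hne
  exact hH_ne u hu (by rw [hc u hu, zero_mul])

/-- Here `H'/H = k/B` and `q' = 1/B`, so `ũ = (k/B) u` leads to form (a). -/
lemma hasListedForm_of_const (hk : k ≠ 0) {B : ℝ} (hB : ∀ u ∈ I, h u = B) :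
    HasListedForm I H K q := by
  have hB0 : B ≠ 0 := by
    obtain ⟨u, hu⟩ := hne
    exact hB u hu ▸ S.ne_zero u hu
  obtain ⟨c₀, hc₀, hHc⟩ := S.exists_factor hI hI' hne hH_ne (F := fun u => Real.exp (k / B * u + 0))
    (fun u _ => (Real.exp_pos _).ne') fun u hu => by
      refine (((hasDerivAt_id u).const_mul (k / B)).add_const 0).exp.congr_deriv ?_
      rw [hB u hu]
      simp
      ring
  obtain ⟨β, hβ⟩ := exists_eq_add_const_of_hasDerivAt hI hI' (f := q)
    (g := fun u => B⁻¹ * u) (r := fun u => 1 / h u) S.hasDerivAt_q fun u hu => by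
      refine ((hasDerivAt_id u).const_mul B⁻¹).congr_deriv ?_
      rw [hB u hu]
      simp
  refine exists_carries_isListed (F := Real.exp) (q' := fun u => u) (e₃ := 0) (e₆ := k / B)
    (c₀ := c₀) (c := c) (α := k⁻¹) (β := β) (div_ne_zero hk hB0) hc₀ (inv_ne_zero hk)
    hHc S.K_eq (fun u hu => ?_) fun σ ε hσ hε _ _ => ?_
  · rw [hβ u hu]
    field_simp
    ring
  · exact .a σ ε hσ hε (fun _ _ => rfl) (fun _ _ => rfl) fun _ _ => rfl

/-- Since `H'/H = (k/A)/(u + B/A)`, `H` is a power with exponent `μ = k/A` of `ũ = κ (u + B/A)`. The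
sign `κ` makes `ũ` positive; it is constant because `h` has no zero on the interval. -/
lemma hasListedForm_of_affine (hk : k ≠ 0) {A B : ℝ} (hA : A ≠ 0)
    (hB : ∀ u ∈ I, h u = A * u + B) : HasListedForm I H K q := by
  obtain ⟨κ, hκ, hpos⟩ : ∃ κ : ℝ, (κ = 1 ∨ κ = -1) ∧ ∀ u ∈ I, 0 < κ * u + κ * B / A := by
    have e : ∀ u ∈ I, u + B / A = h u / A := fun u hu => by
      rw [hB u hu]
      field_simp
    have h0 : ∀ u ∈ I, u + B / A ≠ 0 := fun u hu => by
      rw [e u hu]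
      exact div_ne_zero (S.ne_zero u hu) hA
    rcases pos_or_neg_of_continuousOn hI' (by fun_prop) h0 with h | h
    · exact ⟨1, by simp, fun u hu => by linarith [h u hu, mul_div_assoc 1 B A]⟩
    · exact ⟨-1, by simp, fun u hu => by linarith [h u hu, mul_div_assoc (-1) B A]⟩
  have hκ0 : κ ≠ 0 := by rcases hκ with rfl | rfl <;> norm_num
  have hh : ∀ u ∈ I, h u = A / κ * (κ * u + κ * B / A) := fun u hu => by
    rw [hB u hu]
    field_simp
  have D : ∀ u, HasDerivAt (fun u => κ * u + κ * B / A) κ u := fun u => by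
    simpa using ((hasDerivAt_id u).const_mul κ).add_const (κ * B / A)
  obtain ⟨c₀, hc₀, hHc⟩ := S.exists_factor hI hI' hne hH_ne
    (F := fun u => (κ * u + κ * B / A) ^ (k / A))
    (fun u hu => (Real.rpow_pos_of_pos (hpos u hu) _).ne') fun u hu => by
      have p := hpos u hu
      refine ((D u).rpow_const (p := k / A) (Or.inl p.ne')).congr_deriv ?_
      rw [hh u hu, Real.rpow_sub_one p.ne']
      generalize κ * u + κ * B / A = y at p
      field_simp
  obtain ⟨β, hβ⟩ := exists_eq_add_const_of_hasDerivAt hI hI' (f := q)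
    (g := fun u => A⁻¹ * Real.log (κ * u + κ * B / A)) (r := fun u => 1 / h u) S.hasDerivAt_q
    fun u hu => by
      have p := hpos u hu
      refine (((D u).log p.ne').const_mul A⁻¹).congr_deriv ?_
      rw [hh u hu]
      generalize κ * u + κ * B / A = y at p
      field_simp
  refine exists_carries_isListed (F := fun u => u ^ (k / A)) (q' := Real.log)
    hκ0 hc₀ (inv_ne_zero hA) hHc S.K_eq hβ fun σ ε hσ hε _ _ => ?_
  refine .b σ ε (k / A) hσ hε (div_ne_zero hk hA) ?_ (fun _ _ => rfl) (fun _ _ => rfl)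
    fun _ _ => rfl
  rintro _ ⟨u, hu, rfl⟩
  exact hpos u hu

/-- `h h'' = C H h²` is already the formula for `H` in (g) up to the factor `C⁻¹`, so `u` and `q`
stay unchanged and only `t`, `x` are rescaled. As `K = 0`, its two equations are trivial. -/
lemma hasListedForm_implicit (hk : k ≠ 0) (hd : d ≠ 0) (h₂_ne : ∀ u ∈ I, h₂ u ≠ 0) :
    HasListedForm I H K q := by
  have hc : c = 0 := by
    obtain ⟨u, hu⟩ := hne
    exact (mul_eq_zero.1 (S.degenerate u hu)).resolve_right (h₂_ne u hu)
  have hd1 : ∀ u ∈ I, deriv h u = h₁ u := fun u hu => (S.hasDerivAt_h u hu).deriv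
  have hd2 : ∀ u ∈ I, deriv (deriv h) u = h₂ u := fun u hu => by
    have : deriv h =ᶠ[nhds u] h₁ := Filter.eventuallyEq_of_mem (hI.mem_nhds hu) hd1
    rw [this.deriv_eq, (S.hasDerivAt_h₁ u hu).deriv]
  have quad_ne : ∀ u ∈ I, h₁ u ^ 2 + k * h₁ u + d ≠ 0 := fun u hu =>
    S.quad u hu ▸ mul_ne_zero (S.ne_zero u hu) (h₂_ne u hu)
  obtain ⟨C, hC⟩ := S.exists_h₂_eq hI hI' hH_ne
  have hC0 : C ≠ 0 := by
    obtain ⟨u, hu⟩ := hne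
    rintro rfl
    have := hC u hu
    rw [zero_mul] at this
    exact mul_ne_zero (S.ne_zero u hu) (h₂_ne u hu) this
  obtain ⟨h₀, hh₀, himp⟩ := exists_implicitRelation hI hI' hne S.ne_zero S.hasDerivAt_h
    S.hasDerivAt_h₁ S.quad quad_ne
  refine exists_carries_isListed (F := fun u => (deriv h u ^ 2 + k * deriv h u + d) / h u ^ 2)
    (q' := q) (e₃ := 0) (e₆ := 1) (c₀ := C⁻¹) (α := 1) (β := 0) one_ne_zero (inv_ne_zero hC0)
    one_ne_zero (fun u hu => ?_) S.K_eq (fun u hu => by simp) fun σ ε hσ hε _ hε0 => ?_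
  · rw [one_mul, add_zero, hd1 u hu, ← S.quad u hu, hC u hu]
    have := S.ne_zero u hu
    field_simp
  · have himage : (fun u : ℝ => 1 * u + 0) '' I = I := by simp
    rw [himage]
    obtain rfl := hε0 hc
    refine .g σ k d h₀ h hσ ⟨hk, hd, hh₀, S.smooth, S.ne_zero, ?_, ?_, ?_⟩ (fun _ _ => rfl) ?_
      S.hasDerivAt_q
    · intro u hu
      rw [hd1 u hu]
      exact quad_ne u hu
    · intro u hu
      rw [hd1 u hu, hd2 u hu]
      linear_combination S.quad u hu
    · intro u hu
      rw [hd1 u hu]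
      exact himp u hu
    · simp only [zero_mul, mul_zero]
      refine ⟨contDiffOn_const, fun u _ => ?_⟩
      simp

/-- For `d = 0` both `h` and `h' + k` solve `y' = (h'/h) y`, so `h = m (h' + k)`. Then `h'' = h'/m`,
and `h = m k (1 ± e^z)` for an affine function `z` of `u`. -/
lemma hasListedForm_of_exp (hk : k ≠ 0) (hd : d = 0) (h₂_ne : ∀ u ∈ I, h₂ u ≠ 0) :
    HasListedForm I H K q := by
  subst hd
  have hc : c = 0 := by
    obtain ⟨u, hu⟩ := hne
    exact (mul_eq_zero.1 (S.degenerate u hu)).resolve_right (h₂_ne u hu)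
  have hprod : ∀ u ∈ I, h₁ u * (h₁ u + k) ≠ 0 := fun u hu => by
    have := mul_ne_zero (S.ne_zero u hu) (h₂_ne u hu)
    rw [S.quad u hu] at this
    contrapose! this
    linear_combination this
  have hfac : ∀ u ∈ I, h u * h₂ u = h₁ u * (h₁ u + k) := fun u hu => by
    linear_combination S.quad u hu
  obtain ⟨m, hm⟩ := exists_eq_const_mul_of_hasDerivAt hI hI' (f := h) (g := fun u => h₁ u + k)
    (r := fun u => h₁ u / h u) (fun u hu => right_ne_zero_of_mul (hprod u hu))
    (fun u hu => (S.hasDerivAt_h u hu).congr_deriv (by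
      have := S.ne_zero u hu
      field_simp))
    (fun u hu => ((S.hasDerivAt_h₁ u hu).add_const k).congr_deriv (by
      have := S.ne_zero u hu
      field_simp
      linear_combination hfac u hu))
  have hm0 : m ≠ 0 := by
    rintro rfl
    obtain ⟨u, hu⟩ := hne
    exact S.ne_zero u hu (by rw [hm u hu, zero_mul])
  obtain ⟨n, hn⟩ := exists_eq_const_mul_of_hasDerivAt hI hI' (f := h₁)
    (g := fun u => Real.exp (u / m)) (r := fun _ => 1 / m) (fun u _ => (Real.exp_pos _).ne')
    (fun u hu => (S.hasDerivAt_h₁ u hu).congr_deriv (by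
      have h1 := hfac u hu
      have h2 := right_ne_zero_of_mul (hprod u hu)
      rw [hm u hu] at h1
      field_simp
      apply mul_right_cancel₀ h2
      linear_combination h1))
    (fun u _ => ((hasDerivAt_id u).div_const m).exp.congr_deriv (by simp; ring))
  have hn0 : n ≠ 0 := by
    rintro rfl
    obtain ⟨u, hu⟩ := hne
    exact left_ne_zero_of_mul (hprod u hu) (by rw [hn u hu, zero_mul])
  -- The modulus of `n/k` is absorbed into a shift of `u`; only its sign `s` matters.
  obtain ⟨s, g, hs, hsg⟩ : ∃ s g : ℝ, (s = 1 ∨ s = -1) ∧ n / k = s * Real.exp g := by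
    have h0 : n / k ≠ 0 := div_ne_zero hn0 hk
    rcases h0.lt_or_gt with h | h
    · exact ⟨-1, Real.log (-(n / k)), by simp, by rw [Real.exp_log (by linarith)]; ring⟩
    · exact ⟨1, Real.log (n / k), by simp, by rw [Real.exp_log h]; ring⟩
  have hh : ∀ u ∈ I, h u = m * k * (1 + s * Real.exp (m⁻¹ * u + g)) := fun u hu => by
    have e : n = s * Real.exp g * k := by rw [← hsg]; field_simp
    rw [hm u hu, hn u hu, e, Real.exp_add, show u / m = m⁻¹ * u by ring]
    ring
  have hden : ∀ u ∈ I, 1 + s * Real.exp (m⁻¹ * u + g) ≠ 0 := fun u hu => by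
    have := S.ne_zero u hu
    rw [hh u hu] at this
    exact right_ne_zero_of_mul this
  have DL : ∀ u, HasDerivAt (fun u => m⁻¹ * u + g) m⁻¹ u := fun u => by
    simpa using ((hasDerivAt_id u).const_mul m⁻¹).add_const g
  have DE : ∀ u, HasDerivAt (fun u => 1 + s * Real.exp (m⁻¹ * u + g))
      (s * (Real.exp (m⁻¹ * u + g) * m⁻¹)) u := fun u =>
    (((DL u).exp).const_mul s).const_add 1
  obtain ⟨c₀, hc₀, hHc⟩ := S.exists_factor hI hI' hne hH_ne
    (F := fun u => Real.exp (m⁻¹ * u + g) / (1 + s * Real.exp (m⁻¹ * u + g)))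
    (fun u hu => div_ne_zero (Real.exp_pos _).ne' (hden u hu)) fun u hu => by
      refine ((DL u).exp.div (DE u) (hden u hu)).congr_deriv ?_
      have := hden u hu
      rw [hh u hu]
      generalize Real.exp (m⁻¹ * u + g) = y at this
      field_simp
      ring
  obtain ⟨β, hβ⟩ := exists_eq_add_const_of_hasDerivAt hI hI' (f := q)
    (g := fun u => k⁻¹ * ((m⁻¹ * u + g) - Real.log (1 + s * Real.exp (m⁻¹ * u + g))))
    (r := fun u => 1 / h u) S.hasDerivAt_q
    fun u hu => by
      refine (((DL u).sub ((DE u).log (hden u hu))).const_mul k⁻¹).congr_deriv ?_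
      have := hden u hu
      rw [hh u hu]
      generalize Real.exp (m⁻¹ * u + g) = y at this
      field_simp
      ring
  have hm' := inv_ne_zero hm0
  have hk' := inv_ne_zero hk
  rcases hs with rfl | rfl
  · refine exists_carries_isListed (F := fun u => Real.exp u * (Real.exp u + 1)⁻¹)
      (q' := fun u => u - Real.log (Real.exp u + 1)) (β := β) (e₃ := g)
      hm' hc₀ hk' (fun u hu => ?_) S.K_eq (fun u hu => ?_) fun σ ε hσ _ _ hε => ?_
    · rw [hHc u hu, one_mul, add_comm 1, div_eq_mul_inv]
    · rw [hβ u hu, one_mul, add_comm 1]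
    · obtain rfl := hε hc
      exact .d σ hσ (fun _ _ => rfl) (fun _ _ => by simp) fun _ _ => rfl
  · have hz : ∀ u ∈ I, m⁻¹ * u + g ≠ 0 := fun u hu h0 => hden u hu (by simp [h0])
    have hlog : ∀ y : ℝ, Real.log (1 + -1 * y) = Real.log |y - 1| := fun y => by
      rw [← Real.log_abs, show 1 + -1 * y = -(y - 1) by ring, abs_neg]
    -- Now `H = c₀ e^z/(1 - e^z)`. For `c₀ < 0` this is a positive multiple of `e^z/(e^z - 1)`, form
    -- (e); for `c₀ > 0` it is a positive multiple of `1/(e^{-z} - 1)`, form (c) in the variable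
    -- `-z`. This is why these two forms carry no sign `σ`.
    rcases hc₀.lt_or_gt with hneg | hpos
    · refine exists_carries_isListed (F := fun u => Real.exp u * (Real.exp u - 1)⁻¹)
        (q' := fun u => -u + Real.log |Real.exp u - 1|) (β := β) (c₀ := -c₀) (e₃ := g)
        hm' (neg_ne_zero.2 hc₀) (neg_ne_zero.2 hk') (fun u hu => ?_) S.K_eq (fun u hu => ?_)
        fun σ ε hσ _ hσc hε => ?_
      · rw [hHc u hu, show 1 + -1 * Real.exp (m⁻¹ * u + g) = -(Real.exp (m⁻¹ * u + g) - 1) by ring,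
          div_neg, div_eq_mul_inv]
        ring
      · rw [hβ u hu, hlog]
        ring
      · obtain rfl := hε hc
        have hσ1 : σ = 1 := hσ.resolve_right (by rintro rfl; linarith)
        subst hσ1
        refine .e ?_ (fun _ _ => by simp) (fun _ _ => by simp) fun _ _ => rfl
        rintro _ ⟨u, hu, rfl⟩
        exact hz u hu
    · have hneg : ∀ u, -m⁻¹ * u + -g = -(m⁻¹ * u + g) := fun u => by ring
      refine exists_carries_isListed (F := fun u => (Real.exp u - 1)⁻¹)
        (q' := fun u => Real.log |Real.exp u - 1|) (β := β) (c₀ := c₀) (e₆ := -m⁻¹) (e₃ := -g)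
        (neg_ne_zero.2 hm') hc₀ (neg_ne_zero.2 hk') (fun u hu => ?_) S.K_eq (fun u hu => ?_)
        fun σ ε hσ _ hσc hε => ?_
      · rw [hHc u hu, hneg, Real.exp_neg]
        have h1 := hden u hu
        have h2 := (Real.exp_pos (m⁻¹ * u + g)).ne'
        generalize Real.exp (m⁻¹ * u + g) = y at h1 h2
        rw [show y⁻¹ - 1 = (1 + -1 * y) / y by field_simp; ring, inv_div]
      · rw [hβ u hu, hneg, Real.exp_neg, hlog]
        have h1 := hden u hu
        have h2 := Real.exp_pos (m⁻¹ * u + g)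
        have e : Real.log |(Real.exp (m⁻¹ * u + g))⁻¹ - 1|
            = Real.log |Real.exp (m⁻¹ * u + g) - 1| - (m⁻¹ * u + g) := by
          have h3 := Real.log_exp (m⁻¹ * u + g)
          generalize Real.exp (m⁻¹ * u + g) = y at h1 h2 h3
          have h4 : |y - 1| ≠ 0 := by
            rw [abs_ne_zero]
            contrapose! h1
            linarith
          rw [show y⁻¹ - 1 = -(y - 1) / y by field_simp; ring, abs_div, abs_neg, abs_of_pos h2,
            Real.log_div h4 h2.ne', h3]
        rw [e]
        ring
      · obtain rfl := hε hc
        have hσ1 : σ = 1 := hσ.resolve_right (by rintro rfl; linarith)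
        subst hσ1
        refine .c ?_ (fun _ _ => by simp) (fun _ _ => by simp) fun _ _ => rfl
        rintro _ ⟨u, hu, rfl⟩
        have := neg_ne_zero.2 (hz u hu)
        rwa [← hneg] at this

/-- The classification of the equations that satisfy `SeparationODE` with nonconstant `H`. -/
lemma hasListedForm (hk : k ≠ 0) : HasListedForm I H K q := by
  obtain ⟨C, hC⟩ := S.exists_h₂_eq hI hI' hH_ne
  by_cases hC0 : C = 0
  · have hh₂ : ∀ u ∈ I, h₂ u = 0 := fun u hu => by
      have := hC u hu
      rw [hC0, zero_mul] at this
      exact (mul_eq_zero.1 this).resolve_left (S.ne_zero u hu)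
    obtain ⟨A, hA⟩ := exists_eq_const_of_hasDerivAt_zero hI hI' (f := h₁) fun u hu =>
      hh₂ u hu ▸ S.hasDerivAt_h₁ u hu
    obtain ⟨B, hB⟩ := exists_eq_add_const_of_hasDerivAt hI hI' (f := h) (g := fun u => A * u)
      (r := fun _ => A) (fun u hu => hA u hu ▸ S.hasDerivAt_h u hu) fun u _ => by
        simpa using (hasDerivAt_id u).const_mul A
    by_cases hA0 : A = 0
    · exact S.hasListedForm_of_const hI hI' hne hH_ne hk (B := B) fun u hu => by
        simp [hB u hu, hA0]
    · exact S.hasListedForm_of_affine hI hI' hne hH_ne hk hA0 hB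
  · have h₂_ne : ∀ u ∈ I, h₂ u ≠ 0 := fun u hu h0 => by
      have := hC u hu
      rw [h0, mul_zero] at this
      exact mul_ne_zero hC0 (mul_ne_zero (hH_ne u hu) (pow_ne_zero 2 (S.ne_zero u hu))) this.symm
    by_cases hd : d = 0
    · exact S.hasListedForm_of_exp hI hI' hne hH_ne hk hd h₂_ne
    · exact S.hasListedForm_implicit hI hI' hne hH_ne hk hd h₂_ne

end SeparationODE

/-! ### Necessity: compatibility implies the ODE conditions. -/

lemma ContDiffOn.hasDerivAt_of_isOpen {f : ℝ → ℝ} {s : Set ℝ} (hf : ContDiffOn ℝ ∞ f s)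
    (hs : IsOpen s) {x : ℝ} (hx : x ∈ s) : HasDerivAt f (deriv f x) x :=
  ((hf.differentiableOn (by simp)).differentiableAt (hs.mem_nhds hx)).hasDerivAt

lemma ContDiffOn.smooth_deriv {f : ℝ → ℝ} {s : Set ℝ} (hf : ContDiffOn ℝ ∞ f s)
    (hs : IsOpen s) : ContDiffOn ℝ ∞ (deriv f) s :=
  ((contDiffOn_infty_iff_deriv_of_isOpen hs).1 hf).2

section Slices

variable {f h H P : ℝ → ℝ} {t h₁ H₁ P₁ : ℝ}
  (hf : ∀ᶠ s in nhds t, HasDerivAt f (h (f s) * P s) s)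
  (hh : HasDerivAt h h₁ (f t)) (hP : HasDerivAt P P₁ t)
include hf hh hP

/-- The second derivatives of `u` carry an overall factor `h`, here and in `deriv_flux_slice`;
cancelling it yields the separated equation. -/
lemma hasDerivAt_deriv_slice :
    HasDerivAt (fun s => deriv f s) (h (f t) * (h₁ * P t ^ 2 + P₁)) t := by
  have ft : HasDerivAt f (h (f t) * P t) t := hf.self_of_nhds
  have := (hh.comp t ft).mul hP
  refine (this.congr_of_eventuallyEq ?_).congr_deriv ?_
  · filter_upwards [hf] with s hs using hs.deriv
  · simp only [Function.comp_apply]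
    ring

lemma deriv_flux_slice (hH : HasDerivAt H H₁ (f t)) :
    deriv (fun s => H (f s) * deriv f s) t
      = h (f t) * ((h (f t) * H₁ + H (f t) * h₁) * P t ^ 2 + H (f t) * P₁) := by
  have ft : HasDerivAt f (h (f t) * P t) t := hf.self_of_nhds
  have := (hH.comp t ft).mul (hasDerivAt_deriv_slice hf hh hP)
  rw [HasDerivAt.deriv (f := fun s => H (f s) * deriv f s) this, Function.comp_apply, ft.deriv]
  ring

end Slices

/-- The `t`-derivative of a function with `q(u) = φ(t) + ψ(x)` is `P(t) / q'(u)`. -/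
lemma exists_slice_velocity {I : Set ℝ} {q : ℝ → ℝ} (hI : IsOpen I) (hq : ContDiffOn ℝ ∞ q I)
    (hq' : ∀ v ∈ I, deriv q v ≠ 0) {u : ℝ → ℝ → ℝ} {a b δ : ℝ} (hδ : 0 < δ)
    (hu : ContDiffOn ℝ ∞ (fun p : ℝ × ℝ => u p.1 p.2) (Metric.ball a δ ×ˢ Metric.ball b δ))
    (hmem : ∀ t ∈ Metric.ball a δ, ∀ x ∈ Metric.ball b δ, u t x ∈ I) {φ ψ : ℝ → ℝ}
    (hsep : ∀ t ∈ Metric.ball a δ, ∀ x ∈ Metric.ball b δ, q (u t x) = φ t + ψ x) :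
    ∃ P : ℝ → ℝ, ContDiffOn ℝ ∞ P (Metric.ball a δ) ∧
      ∀ t ∈ Metric.ball a δ, ∀ x ∈ Metric.ball b δ,
        HasDerivAt (fun r => u r x) (1 / deriv q (u t x) * P t) t := by
  have hb : b ∈ Metric.ball b δ := Metric.mem_ball_self hδ
  have slice : ∀ x ∈ Metric.ball b δ, ContDiffOn ℝ ∞ (fun r => u r x) (Metric.ball a δ) :=
    fun x hx => hu.comp (f := fun r => (r, x)) (by fun_prop) fun r hr => ⟨hr, hx⟩
  have comp : ContDiffOn ℝ ∞ (fun r => q (u r b)) (Metric.ball a δ) :=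
    hq.comp (slice b hb) fun r hr => hmem r hr b hb
  -- No regularity of `φ` is assumed, so `P` is the derivative of `q(u)` along the line `x = b`; on
  -- the other lines `q(u)` differs from this by the constant `ψ x - ψ b`.
  refine ⟨deriv fun r => q (u r b), comp.smooth_deriv Metric.isOpen_ball, fun t ht x hx => ?_⟩
  have h1 := (slice x hx).hasDerivAt_of_isOpen Metric.isOpen_ball ht
  have h2 := (hq.hasDerivAt_of_isOpen hI (hmem t ht x hx)).comp t h1
  have h3 : HasDerivAt (fun r => q (u r x)) (deriv (fun r => q (u r b)) t) t := by
    refine ((comp.hasDerivAt_of_isOpen Metric.isOpen_ball ht).add_const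
      (ψ x - ψ b)).congr_of_eventuallyEq ?_
    filter_upwards [Metric.isOpen_ball.mem_nhds ht] with r hr
    rw [hsep r hr x hx, hsep r hr b hb]
    ring
  have h4 := h2.unique h3
  have := hq' _ (hmem t ht x hx)
  refine h1.congr_deriv ?_
  rw [← h4]
  field_simp

/-- The differential consequence of the separated equation obtained by eliminating the third
derivative of `ψ` from its `x`- and `tx`-derivatives. Here `A`, `H`, `B`, `K` are functions of `u`
and a pair such as `A₁`, `A₂` denotes the iterates of `h d/du`. -/
lemma separated_consequence {I : Set ℝ} {h A A₁ A₂ H H₁ H₂ B B₁ B₂ K K₁ K₂ : ℝ → ℝ}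
    {u : ℝ → ℝ → ℝ} {P P₁ S S₁ : ℝ → ℝ} {a b δ p₂ s₂ : ℝ} (hδ : 0 < δ)
    (hmem : ∀ t ∈ Metric.ball a δ, ∀ x ∈ Metric.ball b δ, u t x ∈ I)
    (hA : ∀ v ∈ I, HasDerivAt A (A₁ v) v) (hA₁ : ∀ v ∈ I, HasDerivAt (fun w => h w * A₁ w) (A₂ v) v)
    (hH : ∀ v ∈ I, HasDerivAt H (H₁ v) v) (hH₁ : ∀ v ∈ I, HasDerivAt (fun w => h w * H₁ w) (H₂ v) v)
    (hB : ∀ v ∈ I, HasDerivAt B (B₁ v) v) (hB₁ : ∀ v ∈ I, HasDerivAt (fun w => h w * B₁ w) (B₂ v) v)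
    (hK : ∀ v ∈ I, HasDerivAt K (K₁ v) v) (hK₁ : ∀ v ∈ I, HasDerivAt (fun w => h w * K₁ w) (K₂ v) v)
    (hP : ∀ t ∈ Metric.ball a δ, HasDerivAt P (P₁ t) t) (hP₁ : HasDerivAt P₁ p₂ a)
    (hS : ∀ x ∈ Metric.ball b δ, HasDerivAt S (S₁ x) x) (hS₁ : HasDerivAt S₁ s₂ b)
    (ut : ∀ t ∈ Metric.ball a δ, ∀ x ∈ Metric.ball b δ,
      HasDerivAt (fun r => u r x) (h (u t x) * P t) t)
    (ux : ∀ t ∈ Metric.ball a δ, ∀ x ∈ Metric.ball b δ,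
      HasDerivAt (fun y => u t y) (h (u t x) * S x) x)
    (eq : ∀ t ∈ Metric.ball a δ, ∀ x ∈ Metric.ball b δ, P₁ t + A (u t x) * P t ^ 2
      = H (u t x) * S₁ x + B (u t x) * S x ^ 2 + K (u t x) * S x)
    {v p s m : ℝ} (hv : u a b = v) (hp : P a = p) (hs : S b = s) (hm : S₁ b = m) (hp0 : p ≠ 0) :
    H v * (2 * s * (h v * A₁ v) * (H v * m + B v * s ^ 2 + K v * s - A v * p ^ 2)
        + s * (h v * A₂ v) * p ^ 2 - s * (h v * H₂ v) * m - 2 * (h v * B₁ v) * s * m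
        - (h v * B₂ v) * s ^ 3 - (h v * K₁ v) * m - (h v * K₂ v) * s ^ 2)
      = h v * H₁ v * (s * (h v * A₁ v) * p ^ 2 - s * (h v * H₁ v) * m - 2 * B v * s * m
        - (h v * B₁ v) * s ^ 3 - K v * m - (h v * K₁ v) * s ^ 2) := by
  have ha : a ∈ Metric.ball a δ := Metric.mem_ball_self hδ
  have hb : b ∈ Metric.ball b δ := Metric.mem_ball_self hδ
  have e0 := eq a ha b hb
  have Dt : ∀ {F F' : ℝ → ℝ}, (∀ v ∈ I, HasDerivAt F (F' v) v) → ∀ x ∈ Metric.ball b δ,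
      HasDerivAt (fun r => F (u r x)) (F' (u a x) * (h (u a x) * P a)) a := fun hF x hx =>
    (hF _ (hmem a ha x hx)).comp a (ut a ha x hx)
  have Dx : ∀ {F F' : ℝ → ℝ}, (∀ v ∈ I, HasDerivAt F (F' v) v) →
      HasDerivAt (fun y => F (u a y)) (F' (u a b) * (h (u a b) * S b)) b := fun hF =>
    (hF _ (hmem a ha b hb)).comp b (ux a ha b hb)
  -- `e1` is the `t`-derivative of the separated equation on the whole line `t = a`, so that it can
  -- be differentiated once more in `x` to give `e3`, which removes `p₂`. `e2` is the
  -- `x`-derivative.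
  have e1 : ∀ x ∈ Metric.ball b δ,
      p₂ + (h (u a x) * A₁ (u a x)) * P a ^ 3 + A (u a x) * (2 * P a * P₁ a)
        = P a * ((h (u a x) * H₁ (u a x)) * S₁ x + (h (u a x) * B₁ (u a x)) * S x ^ 2
          + (h (u a x) * K₁ (u a x)) * S x) := by
    intro x hx
    have l := hP₁.add ((Dt hA x hx).mul ((hP a ha).pow 2))
    have r := (((Dt hH x hx).mul_const (S₁ x)).add ((Dt hB x hx).mul_const (S x ^ 2))).add
      ((Dt hK x hx).mul_const (S x))
    have lr := l.unique (r.congr_of_eventuallyEq (by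
      filter_upwards [Metric.isOpen_ball.mem_nhds ha] with t ht using eq t ht x hx))
    simp only [Pi.pow_apply] at lr
    push_cast at lr
    linear_combination lr
  have e2 : (S b * (h (u a b) * A₁ (u a b))) * P a ^ 2
      = S b * (h (u a b) * H₁ (u a b)) * S₁ b + H (u a b) * s₂
        + S b * (h (u a b) * B₁ (u a b)) * S b ^ 2 + B (u a b) * (2 * S b * S₁ b)
        + S b * (h (u a b) * K₁ (u a b)) * S b + K (u a b) * S₁ b := by
    have l := ((Dx hA).mul_const (P a ^ 2)).const_add (P₁ a)
    have r := (((Dx hH).mul hS₁).add ((Dx hB).mul ((hS b hb).pow 2))).add ((Dx hK).mul (hS b hb))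
    have lr := l.unique (r.congr_of_eventuallyEq (by
      filter_upwards [Metric.isOpen_ball.mem_nhds hb] with x hx using eq a ha x hx))
    simp only [Pi.pow_apply] at lr
    push_cast at lr
    linear_combination lr
  have e3 : (S b * (h (u a b) * A₂ (u a b))) * P a ^ 3
        + (S b * (h (u a b) * A₁ (u a b))) * (2 * P a * P₁ a)
      = P a * (S b * (h (u a b) * H₂ (u a b)) * S₁ b + (h (u a b) * H₁ (u a b)) * s₂
        + S b * (h (u a b) * B₂ (u a b)) * S b ^ 2
        + (h (u a b) * B₁ (u a b)) * (2 * S b * S₁ b)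
        + S b * (h (u a b) * K₂ (u a b)) * S b + (h (u a b) * K₁ (u a b)) * S₁ b) := by
    have l := (((Dx hA₁).mul_const (P a ^ 3)).const_add p₂).add
      ((Dx hA).mul_const (2 * P a * P₁ a))
    have r := ((((Dx hH₁).mul hS₁).add ((Dx hB₁).mul ((hS b hb).pow 2))).add
      ((Dx hK₁).mul (hS b hb))).const_mul (P a)
    have lr := l.unique (r.congr_of_eventuallyEq (by
      filter_upwards [Metric.isOpen_ball.mem_nhds hb] with x hx using e1 x hx))
    simp only [Pi.pow_apply] at lr
    push_cast at lr
    linear_combination lr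
  rw [hv, hp, hs, hm] at *
  -- The combination of `e3` and `e2` cancels `s₂`, and `e0` replaces `P₁`. A common factor `p`
  -- remains.
  apply mul_left_cancel₀ hp0
  linear_combination H v * e3 - p * (h v * H₁ v) * e2 - 2 * H v * p * s * (h v * A₁ v) * e0

/-- A polynomial identity in the free parameters yields the equations for its coefficients. -/
lemma coefficients_of_consequence {A A₁ A₂ H H₁ H₂ B B₁ B₂ K K₁ K₂ : ℝ}
    (hX : ∀ p s m : ℝ, p ≠ 0 →
      H * (2 * s * A₁ * (H * m + B * s ^ 2 + K * s - A * p ^ 2)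
        + s * A₂ * p ^ 2 - s * H₂ * m - 2 * B₁ * s * m - B₂ * s ^ 3 - K₁ * m - K₂ * s ^ 2)
      = H₁ * (s * A₁ * p ^ 2 - s * H₁ * m - 2 * B * s * m - B₁ * s ^ 3 - K * m - K₁ * s ^ 2)) :
    H * (A₂ - 2 * A₁ * A) = H₁ * A₁ ∧ H * K₁ = H₁ * K ∧
    H * (2 * A₁ * H - H₂ - 2 * B₁) = -H₁ * (H₁ + 2 * B) ∧
    H * (2 * A₁ * K - K₂) = -H₁ * K₁ := by
  -- Sample values isolating the coefficients of `p² s`, `m`, `s m` and `s²`; the last is the even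
  -- part in `s` at `m = 0`.
  have x1 := hX 1 0 1 one_ne_zero
  have x2 := hX 1 1 0 one_ne_zero
  have x3 := hX 2 1 0 two_ne_zero
  have x4 := hX 1 (-1) 0 one_ne_zero
  have x5 := hX 1 1 1 one_ne_zero
  refine ⟨?_, ?_, ?_, ?_⟩
  · linear_combination (x3 - x2) / 3
  · linear_combination -x1
  · linear_combination x5 - x2 - x1
  · linear_combination (x2 + x4) / 2

lemma PossessesSeparableSolution.separationCriterion {I : Set ℝ} (hI : IsOpen I)
    (hI' : I.OrdConnected) {H K q : ℝ → ℝ} (hH : ContDiffOn ℝ ∞ H I) (hK : ContDiffOn ℝ ∞ K I)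
    (hH_ne : ∀ u ∈ I, H u ≠ 0) (hP : PossessesSeparableSolution I H K q) :
    SeparationCriterion I H K q := by
  obtain ⟨hq, hq', hjet⟩ := hP
  obtain ⟨h, hh⟩ : ∃ h : ℝ → ℝ, h = fun u => 1 / deriv q u := ⟨_, rfl⟩
  have h_ne : ∀ u ∈ I, h u ≠ 0 := fun u hu => by
    rw [hh]
    exact one_div_ne_zero (hq' u hu)
  have hsm : ContDiffOn ℝ ∞ h I := by
    rw [hh]
    exact contDiffOn_const.div (hq.smooth_deriv hI) hq'
  have hd := hsm.smooth_deriv hI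
  have op : ∀ {F : ℝ → ℝ}, ContDiffOn ℝ ∞ F I → ContDiffOn ℝ ∞ (fun w => h w * deriv F w) I :=
    fun hF => hsm.mul (hF.smooth_deriv hI)
  have hB : ContDiffOn ℝ ∞ (fun w => h w * deriv H w + H w * deriv h w) I :=
    (op hH).add (hH.mul hd)
  have Dv : ∀ {F : ℝ → ℝ}, ContDiffOn ℝ ∞ F I → ∀ v ∈ I, HasDerivAt F (deriv F v) v :=
    fun hF v hv => hF.hasDerivAt_of_isOpen hI hv
  have key := fun v (hv : v ∈ I) => coefficients_of_consequence
    (A := deriv h v) (A₁ := h v * deriv (deriv h) v)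
    (A₂ := h v * deriv (fun w => h w * deriv (deriv h) w) v)
    (H := H v) (H₁ := h v * deriv H v) (H₂ := h v * deriv (fun w => h w * deriv H w) v)
    (K := K v) (K₁ := h v * deriv K v) (K₂ := h v * deriv (fun w => h w * deriv K w) v)
    (B := h v * deriv H v + H v * deriv h v)
    (B₁ := h v * deriv (fun w => h w * deriv H w + H w * deriv h w) v)
    (B₂ := h v * deriv (fun w => h w * deriv (fun w => h w * deriv H w + H w * deriv h w) w) v) (by
      intro p s m hp0
      -- This jet is chosen so that `P(0) = p`, `S(0) = s`, `S'(0) = m`, because `u_xx = h (h' S² +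
      -- S')`.
      obtain ⟨U, u, hU, hmU, ⟨husm, hsol⟩, ⟨φ, ψ, hsep⟩, hv0, hut, hux, huxx⟩ :=
        hjet 0 0 v hv (h v * p) (h v * s) (h v * (deriv h v * s ^ 2 + m))
      obtain ⟨δ, hδ, hball⟩ := Metric.isOpen_iff.1 hU _ hmU
      rw [← ball_prod_same] at hball
      have hin : ∀ t ∈ Metric.ball (0 : ℝ) δ, ∀ x ∈ Metric.ball (0 : ℝ) δ, (t, x) ∈ U :=
        fun t ht x hx => hball ⟨ht, hx⟩
      have h00 : (0 : ℝ) ∈ Metric.ball (0 : ℝ) δ := Metric.mem_ball_self hδ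
      have hmem : ∀ t ∈ Metric.ball (0 : ℝ) δ, ∀ x ∈ Metric.ball (0 : ℝ) δ, u t x ∈ I :=
        fun t ht x hx => (hsol t x (hin t ht x hx)).1
      obtain ⟨P, hPs, hPu⟩ := exists_slice_velocity hI hq hq' hδ (husm.mono hball) hmem
        (φ := φ) (ψ := ψ) fun t ht x hx => hsep t x (hin t ht x hx)
      obtain ⟨S, hSs, hSu⟩ := exists_slice_velocity (u := fun x t => u t x) hI hq hq' hδ
        ((husm.mono hball).comp (f := fun p => (p.2, p.1)) (s := Metric.ball 0 δ ×ˢ Metric.ball 0 δ)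
          (contDiff_snd.prodMk contDiff_fst).contDiffOn fun p hp => ⟨hp.2, hp.1⟩)
        (fun x hx t ht => hmem t ht x hx) (φ := ψ) (ψ := φ)
        fun x hx t ht => by rw [hsep t x (hin t ht x hx), add_comm]
      replace hPu : ∀ t ∈ Metric.ball (0 : ℝ) δ, ∀ x ∈ Metric.ball (0 : ℝ) δ,
          HasDerivAt (fun r => u r x) (h (u t x) * P t) t := by simpa only [hh] using hPu
      replace hSu : ∀ t ∈ Metric.ball (0 : ℝ) δ, ∀ x ∈ Metric.ball (0 : ℝ) δ,
          HasDerivAt (fun y => u t y) (h (u t x) * S x) x := fun t ht x hx => by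
        simpa only [hh] using hSu x hx t ht
      have hPd : ∀ t ∈ Metric.ball (0 : ℝ) δ, HasDerivAt P (deriv P t) t := fun t ht =>
        hPs.hasDerivAt_of_isOpen Metric.isOpen_ball ht
      have hSd : ∀ x ∈ Metric.ball (0 : ℝ) δ, HasDerivAt S (deriv S x) x := fun x hx =>
        hSs.hasDerivAt_of_isOpen Metric.isOpen_ball hx
      have hvi : h v ≠ 0 := h_ne v hv
      have hP0 : P 0 = p := by
        rw [(hPu 0 h00 0 h00).deriv, hv0] at hut
        exact mul_left_cancel₀ hvi hut
      have hS0 : S 0 = s := by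
        rw [(hSu 0 h00 0 h00).deriv, hv0] at hux
        exact mul_left_cancel₀ hvi hux
      have evx : ∀ t ∈ Metric.ball (0 : ℝ) δ, ∀ x ∈ Metric.ball (0 : ℝ) δ,
          ∀ᶠ y in nhds x, HasDerivAt (fun z => u t z) (h (u t y) * S y) y := fun t ht x hx => by
        filter_upwards [Metric.isOpen_ball.mem_nhds hx] with y hy using hSu t ht y hy
      have hS1 : deriv S 0 = m := by
        rw [(hasDerivAt_deriv_slice (evx 0 h00 0 h00) (Dv hsm _ (hmem 0 h00 0 h00))
          (hSd 0 h00)).deriv, hv0, hS0] at huxx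
        linarith [mul_left_cancel₀ hvi huxx]
      refine separated_consequence hδ hmem (Dv hd) (Dv (op hd)) (Dv hH) (Dv (op hH))
        (Dv hB) (Dv (op hB)) (Dv hK) (Dv (op hK)) hPd
        ((hPs.smooth_deriv Metric.isOpen_ball).hasDerivAt_of_isOpen Metric.isOpen_ball h00) hSd
        ((hSs.smooth_deriv Metric.isOpen_ball).hasDerivAt_of_isOpen Metric.isOpen_ball h00)
        hPu hSu (fun t ht x hx => ?_) hv0 hP0 hS0 hS1 hp0
      have hpde := (hsol t x (hin t ht x hx)).2
      have hux' := hmem t ht x hx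
      have evt : ∀ᶠ r in nhds t, HasDerivAt (fun z => u z x) (h (u r x) * P r) r := by
        filter_upwards [Metric.isOpen_ball.mem_nhds ht] with r hr using hPu r hr x hx
      rw [(hasDerivAt_deriv_slice evt (Dv hsm _ hux') (hPd t ht)).deriv,
        deriv_flux_slice (evx t ht x hx) (Dv hsm _ hux') (hSd x hx) (Dv hH _ hux'),
        (hSu t ht x hx).deriv] at hpde
      apply mul_left_cancel₀ (h_ne _ hux')
      linear_combination hpde)
  have DH : ∀ v ∈ I, HasDerivAt (fun w => h w * deriv H w)
      (deriv (fun w => h w * deriv H w) v) v := Dv (op hH)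
  have DB : ∀ v ∈ I, deriv (fun w => h w * deriv H w + H w * deriv h w) v
      = deriv (fun w => h w * deriv H w) v
        + (deriv H v * deriv h v + H v * deriv (deriv h) v) := fun v hv =>
    ((DH v hv).add ((Dv hH v hv).mul (Dv hd v hv))).deriv
  -- With `D = h d/du` and `B = D H + H h'`, the `s m` coefficient collapses to `H D²H = (D H)²`, so
  -- `D H / H` is constant.
  have hHH : ∀ v ∈ I, H v * deriv (fun w => h w * deriv H w) v = h v * deriv H v * deriv H v := by
    intro v hv
    have h3 := (key v hv).2.2.1
    rw [DB v hv] at h3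
    apply mul_left_cancel₀ (h_ne v hv)
    linear_combination (-1 / 3) * h3
  obtain ⟨k, hk⟩ := exists_eq_const_mul_of_hasDerivAt hI hI' (f := fun w => h w * deriv H w)
    (g := H) (r := fun v => deriv H v / H v) hH_ne
    (fun v hv => (DH v hv).congr_deriv (by
      have := hH_ne v hv
      field_simp
      linear_combination hHH v hv))
    (fun v hv => (Dv hH v hv).congr_deriv (by
      have := hH_ne v hv
      field_simp))
  obtain ⟨c, hc⟩ := exists_eq_const_mul_of_hasDerivAt hI hI' (f := K)
    (g := H) (r := fun v => deriv H v / H v) hH_ne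
    (fun v hv => (Dv hK v hv).congr_deriv (by
      have := hH_ne v hv
      field_simp
      apply mul_left_cancel₀ (h_ne v hv)
      linear_combination (key v hv).2.1))
    (fun v hv => (Dv hH v hv).congr_deriv (by
      have := hH_ne v hv
      field_simp))
  have hAA : ∀ v ∈ I, deriv (fun w => h w * deriv (deriv h) w) v
      = 2 * deriv (deriv h) v * deriv h v + k * deriv (deriv h) v := by
    intro v hv
    have h1 := (key v hv).1
    rw [hk v hv] at h1
    apply mul_left_cancel₀ (h_ne v hv)
    apply mul_left_cancel₀ (hH_ne v hv)
    linear_combination h1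
  obtain ⟨d, hd'⟩ := exists_eq_add_const_of_hasDerivAt hI hI'
    (f := fun w => h w * deriv (deriv h) w) (g := fun w => deriv h w ^ 2 + k * deriv h w)
    (r := fun v => 2 * deriv (deriv h) v * deriv h v + k * deriv (deriv h) v)
    (fun v hv => (Dv (op hd) v hv).congr_deriv (hAA v hv))
    (fun v hv => (((Dv hd v hv).pow 2).add ((Dv hd v hv).const_mul k)).congr_deriv (by
      push_cast
      ring))
  refine ⟨h, deriv h, deriv (deriv h), k, d, c, hsm, h_ne, fun u hu => ?_, Dv hsm, Dv hd,
    fun u hu => ?_, hd', hc, fun u hu => ?_⟩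
  · refine (Dv hq u hu).congr_deriv ?_
    rw [hh, one_div_one_div]
  · refine (Dv hH u hu).congr_deriv ?_
    rw [← hk u hu]
    have := h_ne u hu
    field_simp
  · have h4 := (key u hu).2.2.2
    have hK1 : ∀ v ∈ I, deriv K v = c * deriv H v := fun v hv => by
      have : K =ᶠ[nhds v] fun w => c * H w := Filter.eventuallyEq_of_mem (hI.mem_nhds hv) hc
      rw [this.deriv_eq, ((Dv hH v hv).const_mul c).deriv]
    have hK2 : deriv (fun w => h w * deriv K w) u = c * deriv (fun w => h w * deriv H w) u := by
      have : (fun w => h w * deriv K w) =ᶠ[nhds u] fun w => c * (h w * deriv H w) := by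
        filter_upwards [hI.mem_nhds hu] with w hw
        rw [hK1 w hw]
        ring
      rw [this.deriv_eq, ((DH u hu).const_mul c).deriv]
    rw [hK2, hK1 u hu, hc u hu] at h4
    -- For `K = c H` the terms with `D²H` and `(D H)²` in the `s²` coefficient cancel by `hHH`,
    -- leaving `2 c H² h h'' = 0`.
    have h5 : h u * H u ^ 2 * (c * deriv (deriv h) u) = 0 := by
      linear_combination h4 / 2 + c * h u / 2 * hHH u hu
    exact (mul_eq_zero.1 h5).resolve_left (mul_ne_zero (h_ne u hu) (pow_ne_zero 2 (hH_ne u hu)))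

/-! ### Sufficiency: construction of separated solutions. -/

/-- A smooth second-order equation in the form `v' = h(v) p`, `p' = N(v, p)` has smooth local
solutions. -/
lemma exists_smooth_solution {I : Set ℝ} (hI : IsOpen I) {h : ℝ → ℝ} {N : ℝ × ℝ → ℝ}
    (hh : ContDiffOn ℝ ∞ h I) (hN : ContDiffOn ℝ ∞ N (I ×ˢ univ)) {v₀ : ℝ} (hv₀ : v₀ ∈ I)
    (p₀ t₀ : ℝ) : ∃ δ > 0, ∃ v p : ℝ → ℝ, v t₀ = v₀ ∧ p t₀ = p₀ ∧
      ContDiffOn ℝ ∞ v (Metric.ball t₀ δ) ∧ ContDiffOn ℝ ∞ p (Metric.ball t₀ δ) ∧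
      ∀ t ∈ Metric.ball t₀ δ, v t ∈ I ∧ HasDerivAt v (h (v t) * p t) t ∧
        HasDerivAt p (N (v t, p t)) t := by
  obtain ⟨F, hF⟩ : ∃ F : ℝ × ℝ → ℝ × ℝ, F = fun z => (h z.1 * z.2, N z) := ⟨_, rfl⟩
  have hopen : IsOpen (I ×ˢ (univ : Set ℝ)) := hI.prod isOpen_univ
  have hFs : ContDiffOn ℝ ∞ F (I ×ˢ univ) := by
    rw [hF]
    exact ((hh.comp contDiffOn_fst fun z hz => hz.1).mul contDiffOn_snd).prodMk hN
  have h0 : (v₀, p₀) ∈ I ×ˢ (univ : Set ℝ) := ⟨hv₀, mem_univ _⟩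
  obtain ⟨z, hz0, ε, hε, hz⟩ :=
    ((hFs.contDiffAt (hopen.mem_nhds h0)).of_le (m := 1) (by exact_mod_cast le_top))
      |>.exists_forall_mem_closedBall_exists_eq_forall_mem_Ioo_hasDerivAt₀ t₀
  have hz' : ∀ t ∈ Metric.ball t₀ ε, HasDerivAt z (F (z t)) t := fun t ht =>
    hz t (by rwa [Real.ball_eq_Ioo] at ht)
  have hcont : ContinuousAt z t₀ := (hz' t₀ (Metric.mem_ball_self hε)).continuousAt
  obtain ⟨η, hη, hmem⟩ := Metric.mem_nhds_iff.1
    (hcont.preimage_mem_nhds (hopen.mem_nhds (hz0 ▸ h0)))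
  -- Strict inequalities keep the closed ball inside both neighbourhoods, as the smoothness of the
  -- solution is derived on a compact interval.
  obtain ⟨δ, hδ, hδε, hδη⟩ : ∃ δ > 0, δ < ε ∧ δ < η :=
    ⟨min ε η / 2, by positivity, by linarith [min_le_left ε η, lt_min hε hη],
      by linarith [min_le_right ε η, lt_min hε hη]⟩
  have hsub : Icc (t₀ - δ) (t₀ + δ) = Metric.closedBall t₀ δ := (Real.closedBall_eq_Icc).symm
  have hzs : ContDiffOn ℝ ∞ z (Metric.ball t₀ δ) := by
    have := ODE.contDiffOn_enat_Icc_of_hasDerivWithinAt (n := ⊤) (f := fun _ => F)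
      (tmin := t₀ - δ) (tmax := t₀ + δ) (u := I ×ˢ univ) (α := z)
      (hFs.comp contDiffOn_snd fun y hy => hy.2)
      (fun t ht => (hz' t (Metric.closedBall_subset_ball hδε (hsub ▸ ht))).hasDerivWithinAt)
      fun t ht => hmem (Metric.closedBall_subset_ball hδη (hsub ▸ ht))
    rw [hsub] at this
    exact this.mono Metric.ball_subset_closedBall
  refine ⟨δ, hδ, fun t => (z t).1, fun t => (z t).2, by simp [hz0], by simp [hz0], hzs.fst, hzs.snd,
    fun t ht => ⟨(hmem (Metric.ball_subset_ball hδη.le ht)).1, ?_⟩⟩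
  have hd := hz' t (Metric.ball_subset_ball hδε.le ht)
  rw [hF] at hd
  exact ⟨(hasFDerivAt_fst (𝕜 := ℝ) (p := z t)).comp_hasDerivAt t hd,
    (hasFDerivAt_snd (𝕜 := ℝ) (p := z t)).comp_hasDerivAt t hd⟩

/-- A smooth function with nonvanishing derivative has a smooth local inverse. -/
lemma exists_smooth_localInverse {I : Set ℝ} (hI : IsOpen I) {q r : ℝ → ℝ}
    (hq : ContDiffOn ℝ ∞ q I) (hq' : ∀ v ∈ I, HasDerivAt q (r v) v) (hr : ∀ v ∈ I, r v ≠ 0)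
    {v₀ : ℝ} (hv₀ : v₀ ∈ I) :
    ∃ (Q : ℝ → ℝ) (W : Set ℝ), IsOpen W ∧ q v₀ ∈ W ∧ ContDiffOn ℝ ∞ Q W ∧
      (∀ w ∈ W, Q w ∈ I ∧ q (Q w) = w ∧ HasDerivAt Q (r (Q w))⁻¹ w) ∧
      ∀ᶠ v in nhds v₀, Q (q v) = v := by
  have h0 : ContDiffAt ℝ ∞ q v₀ := hq.contDiffAt (hI.mem_nhds hv₀)
  have hf := (hq' v₀ hv₀).hasFDerivAt_equiv (hr v₀ hv₀)
  obtain ⟨e, he, hsrc⟩ : ∃ e : OpenPartialHomeomorph ℝ ℝ, (e : ℝ → ℝ) = q ∧ v₀ ∈ e.source :=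
    ⟨h0.toOpenPartialHomeomorph q hf (by simp), rfl,
      h0.mem_toOpenPartialHomeomorph_source hf (by simp)⟩
  have htgt : q v₀ ∈ e.target := he ▸ e.map_source hsrc
  have hinv : e.symm (q v₀) = v₀ := he ▸ e.left_inv hsrc
  have key : ∀ w ∈ e.target ∩ e.symm ⁻¹' I, q (e.symm w) = w := fun w hw => he ▸ e.right_inv hw.1
  refine ⟨e.symm, e.target ∩ e.symm ⁻¹' I, e.isOpen_inter_preimage_symm hI, ⟨htgt, ?_⟩, ?_,
    fun w hw => ⟨hw.2, key w hw, ?_⟩, ?_⟩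
  · rw [mem_preimage, hinv]
    exact hv₀
  · intro w hw
    refine (e.contDiffAt_symm_deriv (hr _ hw.2) hw.1 ?_ ?_).contDiffWithinAt
    · rw [he]
      exact hq' _ hw.2
    · rw [he]
      exact hq.contDiffAt (hI.mem_nhds hw.2)
  · refine e.hasDerivAt_symm hw.1 (hr _ hw.2) ?_
    rw [he]
    exact hq' _ hw.2
  · filter_upwards [e.open_source.mem_nhds hsrc] with v hv
    rw [← he]
    exact e.left_inv hv

/-- Uniqueness for the Goursat problem `E_xt = α E_x + β E` with zero data on the two
characteristics. -/
lemma goursat_uniqueness {a b δ : ℝ} (hδ : 0 < δ) {E G α β : ℝ → ℝ → ℝ}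
    (hE : ∀ t ∈ Metric.ball a δ, ∀ x ∈ Metric.ball b δ, HasDerivAt (fun y => E t y) (G t x) x)
    (hG : ∀ t ∈ Metric.ball a δ, ∀ x ∈ Metric.ball b δ,
      HasDerivAt (fun r => G r x) (α t x * G t x + β t x * E t x) t)
    (hE0 : ∀ t ∈ Metric.ball a δ, E t b = 0) (hG0 : ∀ x ∈ Metric.ball b δ, G a x = 0)
    (cG : ContinuousAt (fun z : ℝ × ℝ => G z.1 z.2) (a, b))
    (cα : ContinuousAt (fun z : ℝ × ℝ => α z.1 z.2) (a, b))
    (cβ : ContinuousAt (fun z : ℝ × ℝ => β z.1 z.2) (a, b)) :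
    ∃ η > 0, η ≤ δ ∧ ∀ t ∈ Metric.ball a η, ∀ x ∈ Metric.ball b η, E t x = 0 := by
  have bdd : ∀ {f : ℝ → ℝ → ℝ}, ContinuousAt (fun z : ℝ × ℝ => f z.1 z.2) (a, b) →
      ∀ᶠ z : ℝ × ℝ in nhds (a, b), |f z.1 z.2| ≤ |f a b| + 1 := fun hf =>
    (hf.abs.eventually (gt_mem_nhds (lt_add_one _))).mono fun z hz => hz.le
  obtain ⟨C, hC, hCα, hCβ⟩ : ∃ C > 0, |α a b| + 1 ≤ C ∧ |β a b| + 1 ≤ C :=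
    ⟨|α a b| + |β a b| + 1, by positivity, by linarith [abs_nonneg (β a b)],
      by linarith [abs_nonneg (α a b)]⟩
  obtain ⟨ρ, hρ, hball⟩ := Metric.eventually_nhds_iff_ball.1 ((bdd cG).and ((bdd cα).and (bdd cβ)))
  -- `η ≤ 1` turns a bound `M` on `G = E_x` into the same bound on `E`; `η ≤ 1/(4C)` then improves
  -- the bound on `G` to `2 C M η ≤ M/2`. Iterating forces `G = 0`.
  obtain ⟨η, hη, hηδ, hηρ, hη1, hηC⟩ : ∃ η > 0, η ≤ δ ∧ η ≤ ρ ∧ η ≤ 1 ∧ η ≤ 1 / (4 * C) :=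
    ⟨min (min δ ρ) (min 1 (1 / (4 * C))), by positivity,
      (min_le_left _ _).trans (min_le_left _ _), (min_le_left _ _).trans (min_le_right _ _),
      (min_le_right _ _).trans (min_le_left _ _), (min_le_right _ _).trans (min_le_right _ _)⟩
  have ha : a ∈ Metric.ball a η := Metric.mem_ball_self hη
  have hb : b ∈ Metric.ball b η := Metric.mem_ball_self hη
  have up : ∀ {c y : ℝ}, y ∈ Metric.ball c η → y ∈ Metric.ball c δ := fun h =>
    Metric.ball_subset_ball hηδ h
  have loc : ∀ t ∈ Metric.ball a η, ∀ x ∈ Metric.ball b η,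
      |G t x| ≤ |G a b| + 1 ∧ |α t x| ≤ C ∧ |β t x| ≤ C := fun t ht x hx => by
    have := hball (t, x) (by
      rw [← ball_prod_same]
      exact ⟨Metric.ball_subset_ball hηρ ht, Metric.ball_subset_ball hηρ hx⟩)
    exact ⟨this.1, this.2.1.trans hCα, this.2.2.trans hCβ⟩
  have bE : ∀ M, (∀ t ∈ Metric.ball a η, ∀ x ∈ Metric.ball b η, |G t x| ≤ M) →
      ∀ t ∈ Metric.ball a η, ∀ x ∈ Metric.ball b η, |E t x| ≤ M := by
    intro M hM t ht x hx
    have h1 := Convex.norm_image_sub_le_of_norm_hasDerivWithin_le (f := fun y => E t y)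
      (fun y hy => (hE t (up ht) y (up hy)).hasDerivWithinAt) (hM t ht) (convex_ball b η) hb hx
    simp only [hE0 t (up ht), sub_zero, Real.norm_eq_abs] at h1
    have h2 : |x - b| < η := hx
    have h3 : 0 ≤ M := (abs_nonneg _).trans (hM t ht x hx)
    exact h1.trans (mul_le_of_le_one_right h3 (h2.le.trans hη1))
  have half : ∀ M, (∀ t ∈ Metric.ball a η, ∀ x ∈ Metric.ball b η, |G t x| ≤ M) →
      ∀ t ∈ Metric.ball a η, ∀ x ∈ Metric.ball b η, |G t x| ≤ M / 2 := by
    intro M hM t ht x hx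
    have h3 : 0 ≤ M := (abs_nonneg _).trans (hM t ht x hx)
    have h1 := Convex.norm_image_sub_le_of_norm_hasDerivWithin_le (f := fun r => G r x)
      (C := 2 * C * M) (fun r hr => (hG r (up hr) x (up hx)).hasDerivWithinAt) (fun r hr => by
        obtain ⟨-, l2, l3⟩ := loc r hr x hx
        calc |α r x * G r x + β r x * E r x| ≤ |α r x| * |G r x| + |β r x| * |E r x| := by
              rw [← abs_mul, ← abs_mul]
              exact abs_add_le _ _
          _ ≤ C * M + C * M := by
              gcongr
              · exact hM r hr x hx
              · exact bE M hM r hr x hx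
          _ = 2 * C * M := by ring) (convex_ball a η) ha ht
    simp only [hG0 x (up hx), sub_zero, Real.norm_eq_abs] at h1
    have h2 : |t - a| < η := ht
    calc |G t x| ≤ 2 * C * M * |t - a| := h1
      _ ≤ 2 * C * M * (1 / (4 * C)) := by
          gcongr
          exact h2.le.trans hηC
      _ = M / 2 := by
          field_simp
          ring
  have iter : ∀ n : ℕ, ∀ t ∈ Metric.ball a η, ∀ x ∈ Metric.ball b η,
      |G t x| ≤ (|G a b| + 1) / 2 ^ n := by
    intro n
    induction n with
    | zero => simpa using fun t ht x hx => (loc t ht x hx).1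
    | succ n ih =>
      intro t ht x hx
      refine (half _ ih t ht x hx).trans_eq ?_
      rw [pow_succ]
      field_simp
  have zero : ∀ t ∈ Metric.ball a η, ∀ x ∈ Metric.ball b η, |G t x| ≤ 0 := fun t ht x hx => by
    have lim : Filter.Tendsto (fun n : ℕ => (|G a b| + 1) / 2 ^ n) Filter.atTop (nhds 0) :=
      tendsto_const_nhds.div_atTop (tendsto_pow_atTop_atTop_of_one_lt one_lt_two)
    exact ge_of_tendsto' lim fun n => iter n t ht x hx
  exact ⟨η, hη, hηδ, fun t ht x hx => abs_nonpos_iff.1 (bE 0 zero t ht x hx)⟩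

namespace SeparationODE

variable {I : Set ℝ} (hI : IsOpen I)
  {H K q h h₁ h₂ : ℝ → ℝ} {k d c : ℝ} (S : SeparationODE I H K q h h₁ h₂ k d c)
include hI S

lemma smooth_h₁ : ContDiffOn ℝ ∞ h₁ I :=
  (S.smooth.smooth_deriv hI).congr fun u hu => (S.hasDerivAt_h u hu).deriv.symm

lemma smooth_q : ContDiffOn ℝ ∞ q I := by
  rw [contDiffOn_infty_iff_deriv_of_isOpen hI]
  refine ⟨fun u hu => (S.hasDerivAt_q u hu).differentiableAt.differentiableWithinAt, ?_⟩
  exact (contDiffOn_const.div S.smooth S.ne_zero).congr fun u hu => (S.hasDerivAt_q u hu).deriv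

omit hI in
/-- If the separated equation holds along the two coordinate lines through a point, then it holds
near that point. -/
lemma separated_of_characteristics {u : ℝ → ℝ → ℝ}
    {P P₁ V V₁ V₂ : ℝ → ℝ} {a b δ : ℝ} (hδ : 0 < δ)
    (hmem : ∀ t ∈ Metric.ball a δ, ∀ x ∈ Metric.ball b δ, u t x ∈ I)
    (hu : ContinuousAt (fun z : ℝ × ℝ => u z.1 z.2) (a, b))
    (hP : ∀ t ∈ Metric.ball a δ, HasDerivAt P (P₁ t) t)
    (hV : ∀ x ∈ Metric.ball b δ, HasDerivAt V (V₁ x) x)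
    (hV₁ : ∀ x ∈ Metric.ball b δ, HasDerivAt V₁ (V₂ x) x) (hV₂ : ContinuousAt V₂ b)
    (ut : ∀ t ∈ Metric.ball a δ, ∀ x ∈ Metric.ball b δ,
      HasDerivAt (fun r => u r x) (h (u t x) * P t) t)
    (ux : ∀ t ∈ Metric.ball a δ, ∀ x ∈ Metric.ball b δ,
      HasDerivAt (fun y => u t y) (h (u t x) * V x) x)
    (e₁ : ∀ t ∈ Metric.ball a δ, P₁ t + h₁ (u t b) * P t ^ 2
      = H (u t b) * (V₁ b + (k + h₁ (u t b)) * V b ^ 2 + c * V b))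
    (e₂ : ∀ x ∈ Metric.ball b δ, P₁ a + h₁ (u a x) * P a ^ 2
      = H (u a x) * (V₁ x + (k + h₁ (u a x)) * V x ^ 2 + c * V x)) :
    ∃ η > 0, η ≤ δ ∧ ∀ t ∈ Metric.ball a η, ∀ x ∈ Metric.ball b η,
      P₁ t + h₁ (u t x) * P t ^ 2
        = H (u t x) * (V₁ x + (k + h₁ (u t x)) * V x ^ 2 + c * V x) := by
  have ha : a ∈ Metric.ball a δ := Metric.mem_ball_self hδ
  have hb : b ∈ Metric.ball b δ := Metric.mem_ball_self hδ
  obtain ⟨R, hR⟩ : ∃ R : ℝ → ℝ, R = fun v => h₁ v ^ 2 + k * h₁ v + d := ⟨_, rfl⟩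
  have Rq : ∀ v ∈ I, h v * h₂ v = R v := fun v hv => by rw [hR, S.quad v hv]
  have cR : ∀ v ∈ I, c * R v = 0 := fun v hv => by
    rw [← Rq v hv]
    linear_combination h v * S.degenerate v hv
  have DA : ∀ {f : ℝ → ℝ} {s P : ℝ}, f s ∈ I → HasDerivAt f (h (f s) * P) s →
      HasDerivAt (fun r => h₁ (f r)) (R (f s) * P) s := fun hs hf =>
    ((S.hasDerivAt_h₁ _ hs).comp _ hf).congr_deriv (by rw [← Rq _ hs]; ring)
  have DH : ∀ {f : ℝ → ℝ} {s P : ℝ}, f s ∈ I → HasDerivAt f (h (f s) * P) s →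
      HasDerivAt (fun r => H (f r)) (k * H (f s) * P) s := fun hs hf =>
    ((S.hasDerivAt_H _ hs).comp _ hf).congr_deriv (by
      have := S.ne_zero _ hs
      field_simp)
  have DR : ∀ {f : ℝ → ℝ} {s P : ℝ}, f s ∈ I → HasDerivAt f (h (f s) * P) s →
      HasDerivAt (fun r => R (f r)) ((2 * h₁ (f s) + k) * R (f s) * P) s := fun hs hf => by
    rw [hR]
    refine ((((DA hs hf).pow 2).add ((DA hs hf).const_mul k)).add_const d).congr_deriv ?_
    push_cast
    rw [hR]
    ring
  obtain ⟨E, hE⟩ : ∃ E : ℝ → ℝ → ℝ, E = fun t x => P₁ t + h₁ (u t x) * P t ^ 2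
    - H (u t x) * (V₁ x + (k + h₁ (u t x)) * V x ^ 2 + c * V x) := ⟨_, rfl⟩
  obtain ⟨G, hG⟩ : ∃ G : ℝ → ℝ → ℝ, G = fun t x => R (u t x) * V x * P t ^ 2
    - H (u t x) * (k * V x * (V₁ x + (k + h₁ (u t x)) * V x ^ 2 + c * V x)
      + (V₂ x + R (u t x) * V x ^ 3 + (k + h₁ (u t x)) * (2 * V x * V₁ x) + c * V₁ x)) :=
    ⟨_, rfl⟩
  have hEx : ∀ t ∈ Metric.ball a δ, ∀ x ∈ Metric.ball b δ,
      HasDerivAt (fun y => E t y) (G t x) x := by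
    intro t ht x hx
    have m := hmem t ht x hx
    have dA := DA m (ux t ht x hx)
    have dH := DH m (ux t ht x hx)
    rw [hE, hG]
    refine (((dA.mul_const (P t ^ 2)).const_add (P₁ t)).sub (dH.mul
      (((hV₁ x hx).add ((dA.const_add k).mul ((hV x hx).pow 2))).add
        ((hV x hx).const_mul c)))).congr_deriv ?_
    simp only [Pi.add_apply, Pi.mul_apply, Pi.pow_apply]
    push_cast
    ring
  have m₀ := hmem a ha b hb
  have cu : ∀ {f : ℝ → ℝ}, ContinuousAt f (u a b) →
      ContinuousAt (fun z : ℝ × ℝ => f (u z.1 z.2)) (a, b) := fun hf =>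
    ContinuousAt.comp (x := (a, b)) (f := fun z : ℝ × ℝ => u z.1 z.2) hf hu
  have cs : ∀ {f : ℝ → ℝ}, ContinuousAt f b →
      ContinuousAt (fun z : ℝ × ℝ => f z.2) (a, b) := fun hf =>
    ContinuousAt.comp (x := (a, b)) (f := Prod.snd) hf continuousAt_snd
  have cA := cu (S.hasDerivAt_h₁ _ m₀).continuousAt
  have cH := cu (S.hasDerivAt_H _ m₀).continuousAt
  have cRu : ContinuousAt (fun z : ℝ × ℝ => R (u z.1 z.2)) (a, b) := by
    rw [hR]
    exact ((cA.pow 2).add (continuousAt_const.mul cA)).add continuousAt_const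
  have cV := cs (hV b hb).continuousAt
  have cV₁ := cs (hV₁ b hb).continuousAt
  have cV₂ := cs hV₂
  have cP : ContinuousAt (fun z : ℝ × ℝ => P z.1) (a, b) :=
    ContinuousAt.comp (x := (a, b)) (f := Prod.fst) (hP a ha).continuousAt continuousAt_fst
  -- With `R = h h''`, which satisfies `h R' = (2h' + k) R`, the defect obeys `E_xt = k P E_x + 2 R
  -- V P E + 2 c R H V² P`. The last term vanishes because `c R = 0`.
  obtain ⟨η, hη, hηδ, hη0⟩ := goursat_uniqueness hδ (E := E) (G := G)
    (α := fun t _ => k * P t) (β := fun t x => 2 * R (u t x) * V x * P t) hEx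
    (fun t ht x hx => by
      have m := hmem t ht x hx
      have dA := DA (f := fun r => u r x) m (ut t ht x hx)
      have dH := DH (f := fun r => u r x) m (ut t ht x hx)
      have dR := DR (f := fun r => u r x) m (ut t ht x hx)
      rw [hE, hG]
      refine (((dR.mul_const (V x)).mul ((hP t ht).pow 2)).sub (dH.mul
        (((((dA.const_add k).mul_const (V x ^ 2)).const_add (V₁ x)).add_const
          (c * V x)).const_mul (k * V x) |>.add
        ((((dR.mul_const (V x ^ 3)).const_add (V₂ x)).add
          ((dA.const_add k).mul_const (2 * V x * V₁ x))).add_const (c * V₁ x))))).congr_deriv ?_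
      simp only [Pi.add_apply, Pi.pow_apply]
      push_cast
      linear_combination 2 * H (u t x) * V x ^ 2 * P t * cR _ m)
    (fun t ht => by rw [hE]; exact sub_eq_zero.2 (e₁ t ht))
    (fun x hx => by
      refine (hEx a ha x hx).unique ((hasDerivAt_const x (0 : ℝ)).congr_of_eventuallyEq ?_)
      filter_upwards [Metric.isOpen_ball.mem_nhds hx] with y hy
      rw [hE]
      exact sub_eq_zero.2 (e₂ y hy))
    (by
      rw [hG]
      exact ((cRu.mul cV).mul (cP.pow 2)).sub (cH.mul (((continuousAt_const.mul cV).mul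
        ((cV₁.add ((continuousAt_const.add cA).mul (cV.pow 2))).add
          (continuousAt_const.mul cV))).add
        (((cV₂.add (cRu.mul (cV.pow 3))).add ((continuousAt_const.add cA).mul
          ((continuousAt_const.mul cV).mul cV₁))).add (continuousAt_const.mul cV₁)))))
    (continuousAt_const.mul cP) (((continuousAt_const.mul cRu).mul cV).mul cP)
  refine ⟨η, hη, hηδ, fun t ht x hx => sub_eq_zero.1 ?_⟩
  have := hη0 t ht x hx
  rwa [hE] at this

lemma possessesSeparableSolution (hH : ContDiffOn ℝ ∞ H I) (hH_ne : ∀ u ∈ I, H u ≠ 0) :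
    PossessesSeparableSolution I H K q := by
  have hqs := S.smooth_q hI
  have hA := S.smooth_h₁ hI
  refine ⟨hqs, fun v hv => by
    rw [(S.hasDerivAt_q v hv).deriv]
    exact one_div_ne_zero (S.ne_zero v hv), ?_⟩
  intro t₀ x₀ u₀ hu₀ ut ux uxx
  have hh₀ := S.ne_zero u₀ hu₀
  obtain ⟨p₀, hp₀⟩ : ∃ p₀, p₀ = ut / h u₀ := ⟨_, rfl⟩
  obtain ⟨s₀, hs₀⟩ : ∃ s₀, s₀ = ux / h u₀ := ⟨_, rfl⟩
  obtain ⟨m, hm⟩ : ∃ m, m = uxx / h u₀ - h₁ u₀ * s₀ ^ 2 := ⟨_, rfl⟩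
  have c1 : ∀ {f : ℝ → ℝ}, ContDiffOn ℝ ∞ f I →
      ContDiffOn ℝ ∞ (fun z : ℝ × ℝ => f z.1) (I ×ˢ univ) := fun hf =>
    hf.comp contDiffOn_fst fun z hz => hz.1
  -- `v` will be `u` on the line `x = x₀`: it solves the separated equation with `S`, `S'` frozen at
  -- `s₀`, `m`. Then `r` is the resulting value of `P'` at `t₀`, and `y` is the analogue on `t = t₀`
  -- with `P`, `P'` frozen at `p₀`, `r`, so that the two agree at the corner.
  obtain ⟨δ₁, hδ₁, v, p, hv0, hp0, hvs, hps, hvp⟩ := exists_smooth_solution hI S.smooth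
    (N := fun z => H z.1 * (m + (k + h₁ z.1) * s₀ ^ 2 + c * s₀) - h₁ z.1 * z.2 ^ 2)
    (((c1 hH).mul ((contDiffOn_const.add ((contDiffOn_const.add (c1 hA)).mul
      contDiffOn_const)).add contDiffOn_const)).sub ((c1 hA).mul (contDiffOn_snd.pow 2)))
    hu₀ p₀ t₀
  obtain ⟨r, hr⟩ : ∃ r, r = H u₀ * (m + (k + h₁ u₀) * s₀ ^ 2 + c * s₀) - h₁ u₀ * p₀ ^ 2 :=
    ⟨_, rfl⟩
  obtain ⟨δ₂, hδ₂, y, s, hy0, hs0, hys, hss, hysd⟩ := exists_smooth_solution hI S.smooth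
    (N := fun z => (r + h₁ z.1 * p₀ ^ 2) / H z.1 - (k + h₁ z.1) * z.2 ^ 2 - c * z.2)
    ((((contDiffOn_const.add ((c1 hA).mul contDiffOn_const)).div (c1 hH)
      fun z hz => hH_ne _ hz.1).sub ((contDiffOn_const.add (c1 hA)).mul
      (contDiffOn_snd.pow 2))).sub (contDiffOn_const.mul contDiffOn_snd)) hu₀ s₀ x₀
  obtain ⟨Q, W, hW, hwW, hQs, hQ, hQq⟩ := exists_smooth_localInverse hI hqs S.hasDerivAt_q
    (fun v hv => one_div_ne_zero (S.ne_zero v hv)) hu₀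
  have ht₁ : t₀ ∈ Metric.ball t₀ δ₁ := Metric.mem_ball_self hδ₁
  have hx₂ : x₀ ∈ Metric.ball x₀ δ₂ := Metric.mem_ball_self hδ₂
  -- Subtracting `q u₀`, which both summands contain at the corner, makes `u = Q(w)` restrict to `v`
  -- and `y` on the two lines.
  obtain ⟨w, hw⟩ : ∃ w : ℝ → ℝ → ℝ, w = fun t x => q (v t) + q (y x) - q u₀ := ⟨_, rfl⟩
  have hws : ContDiffOn ℝ ∞ (fun z : ℝ × ℝ => w z.1 z.2)
      (Metric.ball t₀ δ₁ ×ˢ Metric.ball x₀ δ₂) := by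
    rw [hw]
    exact (((hqs.comp hvs fun t ht => (hvp t ht).1).comp contDiffOn_fst fun z hz => hz.1).add
      ((hqs.comp hys fun x hx => (hysd x hx).1).comp contDiffOn_snd fun z hz => hz.2)).sub
      contDiffOn_const
  have hbox : Metric.ball t₀ δ₁ ×ˢ Metric.ball x₀ δ₂ ∈ nhds (t₀, x₀) :=
    (Metric.isOpen_ball.prod Metric.isOpen_ball).mem_nhds ⟨ht₁, hx₂⟩
  have hw0 : w t₀ x₀ = q u₀ := by
    rw [hw]
    simp [hv0, hy0]
  have ev : ∀ᶠ z : ℝ × ℝ in nhds (t₀, x₀), (z.1 ∈ Metric.ball t₀ δ₁ ∧ z.2 ∈ Metric.ball x₀ δ₂) ∧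
      w z.1 z.2 ∈ W ∧ Q (q (v z.1)) = v z.1 ∧ Q (q (y z.2)) = y z.2 := by
    have cv : ContinuousAt (fun z : ℝ × ℝ => v z.1) (t₀, x₀) := ContinuousAt.comp (x := (t₀, x₀))
      (f := Prod.fst) (hvp t₀ ht₁).2.1.continuousAt continuousAt_fst
    have cy : ContinuousAt (fun z : ℝ × ℝ => y z.2) (t₀, x₀) := ContinuousAt.comp (x := (t₀, x₀))
      (f := Prod.snd) (hysd x₀ hx₂).2.1.continuousAt continuousAt_snd
    filter_upwards [hbox, (hws.continuousOn.continuousAt hbox).preimage_mem_nhds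
      (hW.mem_nhds (by simpa only [hw0] using hwW)),
      cv.eventually (by simpa only [hv0] using hQq),
      cy.eventually (by simpa only [hy0] using hQq)] with z h1 h2 h3 h4
    exact ⟨h1, h2, h3, h4⟩
  obtain ⟨δ, hδ, hball⟩ := Metric.eventually_nhds_iff_ball.1 ev
  rw [← ball_prod_same] at hball
  have ht₀ : t₀ ∈ Metric.ball t₀ δ := Metric.mem_ball_self hδ
  have hx₀ : x₀ ∈ Metric.ball x₀ δ := Metric.mem_ball_self hδ
  have box : ∀ t ∈ Metric.ball t₀ δ, ∀ x ∈ Metric.ball x₀ δ,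
      (t ∈ Metric.ball t₀ δ₁ ∧ x ∈ Metric.ball x₀ δ₂) ∧
      w t x ∈ W ∧ Q (q (v t)) = v t ∧ Q (q (y x)) = y x :=
    fun t ht x hx => hball (t, x) ⟨ht, hx⟩
  obtain ⟨u, hu⟩ : ∃ u : ℝ → ℝ → ℝ, u = fun t x => Q (w t x) := ⟨_, rfl⟩
  have hus : ContDiffOn ℝ ∞ (fun z : ℝ × ℝ => u z.1 z.2)
      (Metric.ball t₀ δ ×ˢ Metric.ball x₀ δ) := by
    rw [hu]
    exact hQs.comp (hws.mono fun z hz => (box z.1 hz.1 z.2 hz.2).1)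
      fun z hz => (box z.1 hz.1 z.2 hz.2).2.1
  have hmem : ∀ t ∈ Metric.ball t₀ δ, ∀ x ∈ Metric.ball x₀ δ, u t x ∈ I := fun t ht x hx => by
    rw [hu]
    exact (hQ _ (box t ht x hx).2.1).1
  have hut : ∀ t ∈ Metric.ball t₀ δ, ∀ x ∈ Metric.ball x₀ δ,
      HasDerivAt (fun r => u r x) (h (u t x) * p t) t := by
    intro t ht x hx
    obtain ⟨⟨b1, b2⟩, b3, -⟩ := box t ht x hx
    obtain ⟨hvI, dv, -⟩ := hvp t b1
    have dw : HasDerivAt (fun r => w r x) (p t) t := by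
      rw [hw]
      refine ((((S.hasDerivAt_q _ hvI).comp t dv).add_const (q (y x))).sub_const
        (q u₀)).congr_deriv ?_
      have := S.ne_zero _ hvI
      field_simp
    refine (HasDerivAt.comp t (hQ _ b3).2.2 dw).congr_deriv ?_ |>.congr_of_eventuallyEq ?_
    · rw [hu, one_div, inv_inv]
    · rw [hu]
      rfl
  have hux : ∀ t ∈ Metric.ball t₀ δ, ∀ x ∈ Metric.ball x₀ δ,
      HasDerivAt (fun z => u t z) (h (u t x) * s x) x := by
    intro t ht x hx
    obtain ⟨⟨b1, b2⟩, b3, -⟩ := box t ht x hx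
    obtain ⟨hyI, dy, -⟩ := hysd x b2
    have dw : HasDerivAt (fun z => w t z) (s x) x := by
      rw [hw]
      refine ((((S.hasDerivAt_q _ hyI).comp x dy).const_add (q (v t))).sub_const
        (q u₀)).congr_deriv ?_
      have := S.ne_zero _ hyI
      field_simp
    refine (HasDerivAt.comp x (hQ _ b3).2.2 dw).congr_deriv ?_ |>.congr_of_eventuallyEq ?_
    · rw [hu, one_div, inv_inv]
    · rw [hu]
      rfl
  have hub : ∀ t ∈ Metric.ball t₀ δ, u t x₀ = v t := fun t ht => by
    rw [hu, hw]
    simpa [hy0] using (box t ht x₀ hx₀).2.2.1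
  have hua : ∀ x ∈ Metric.ball x₀ δ, u t₀ x = y x := fun x hx => by
    rw [hu, hw]
    simpa [hv0] using (box t₀ ht₀ x hx).2.2.2
  have hu0 : u t₀ x₀ = u₀ := by rw [hub t₀ ht₀, hv0]
  have dp : ∀ t ∈ Metric.ball t₀ δ, HasDerivAt p
      (H (v t) * (m + (k + h₁ (v t)) * s₀ ^ 2 + c * s₀) - h₁ (v t) * p t ^ 2) t :=
    fun t ht => (hvp t (box t ht x₀ hx₀).1.1).2.2
  have ds : ∀ x ∈ Metric.ball x₀ δ, HasDerivAt s
      ((r + h₁ (y x) * p₀ ^ 2) / H (y x) - (k + h₁ (y x)) * s x ^ 2 - c * s x) x :=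
    fun x hx => (hysd x (box t₀ ht₀ x hx).1.2).2.2
  have hss' : ContDiffOn ℝ ∞ s (Metric.ball x₀ δ) :=
    hss.mono fun x hx => (box t₀ ht₀ x hx).1.2
  have hs1 := hss'.smooth_deriv Metric.isOpen_ball
  have ds' : ∀ x ∈ Metric.ball x₀ δ, HasDerivAt s (deriv s x) x := fun x hx =>
    hss'.hasDerivAt_of_isOpen Metric.isOpen_ball hx
  have hsm : deriv s x₀ = m := by
    rw [(ds x₀ hx₀).deriv, hy0, hs0, hr]
    have := hH_ne u₀ hu₀
    field_simp
    ring
  have hpr : deriv p t₀ = r := by rw [(dp t₀ ht₀).deriv, hv0, hp0, hr]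
  obtain ⟨η, hη, hηδ, hE⟩ := S.separated_of_characteristics hδ hmem
    (hus.continuousOn.continuousAt ((Metric.isOpen_ball.prod Metric.isOpen_ball).mem_nhds
      ⟨ht₀, hx₀⟩)) (P₁ := deriv p) (fun t ht => (dp t ht).differentiableAt.hasDerivAt) ds'
    (fun x hx => hs1.hasDerivAt_of_isOpen Metric.isOpen_ball hx)
    ((hs1.smooth_deriv Metric.isOpen_ball).continuousOn.continuousAt
      (Metric.isOpen_ball.mem_nhds hx₀)) hut hux
    (fun t ht => by
      rw [hub t ht, (dp t ht).deriv, hsm, hs0]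
      ring)
    (fun x hx => by
      rw [hua x hx, (ds x hx).deriv, hpr, hp0]
      have := hH_ne _ (hysd x (box t₀ ht₀ x hx).1.2).1
      field_simp
      ring)
  have up : ∀ {c z : ℝ}, z ∈ Metric.ball c η → z ∈ Metric.ball c δ := fun h =>
    Metric.ball_subset_ball hηδ h
  have evx : ∀ t ∈ Metric.ball t₀ δ, ∀ x ∈ Metric.ball x₀ δ,
      ∀ᶠ z in nhds x, HasDerivAt (fun z => u t z) (h (u t z) * s z) z := fun t ht x hx => by
    filter_upwards [Metric.isOpen_ball.mem_nhds hx] with z hz using hux t ht z hz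
  refine ⟨Metric.ball t₀ η ×ˢ Metric.ball x₀ η, u, Metric.isOpen_ball.prod Metric.isOpen_ball,
    ⟨Metric.mem_ball_self hη, Metric.mem_ball_self hη⟩,
    ⟨hus.mono (prod_mono (fun _ => up) fun _ => up), ?_⟩,
    ⟨fun t => q (v t), fun x => q (y x) - q u₀, ?_⟩, hu0, ?_, ?_, ?_⟩
  · rintro t x ⟨ht, hx⟩
    have mI := hmem t (up ht) x (up hx)
    refine ⟨mI, ?_⟩
    have evt : ∀ᶠ z in nhds t, HasDerivAt (fun z => u z x) (h (u z x) * p z) z := by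
      filter_upwards [Metric.isOpen_ball.mem_nhds (up ht)] with z hz using hut z hz x (up hx)
    rw [(hasDerivAt_deriv_slice evt (S.hasDerivAt_h _ mI)
        (dp t (up ht)).differentiableAt.hasDerivAt).deriv,
      deriv_flux_slice (evx t (up ht) x (up hx)) (S.hasDerivAt_h _ mI) (ds' x (up hx))
        (S.hasDerivAt_H _ mI), (hux t (up ht) x (up hx)).deriv, S.K_eq _ mI]
    have e : h (u t x) * (k * H (u t x) / h (u t x)) = k * H (u t x) := by
      have := S.ne_zero _ mI
      field_simp
    rw [e]
    linear_combination h (u t x) * hE t ht x hx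
  · rintro t x ⟨ht, hx⟩
    have := (hQ _ (box t (up ht) x (up hx)).2.1).2.1
    rw [hu]
    simp only [this]
    rw [hw]
    ring
  · rw [(hut t₀ ht₀ x₀ hx₀).deriv, hu0, hp0, hp₀]
    field_simp
  · rw [(hux t₀ ht₀ x₀ hx₀).deriv, hu0, hs0, hs₀]
    field_simp
  · have mI := hmem t₀ ht₀ x₀ hx₀
    rw [(hasDerivAt_deriv_slice (evx t₀ ht₀ x₀ hx₀) (S.hasDerivAt_h _ mI) (ds' x₀ hx₀)).deriv,
      hu0, hs0, hsm, hm]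
    field_simp
    ring

end SeparationODE

theorem mainTheorem5 (I : Set ℝ) (hI_open : IsOpen I) (hI_conn : I.OrdConnected)
    (hI_ne : I.Nonempty) (H K : ℝ → ℝ)
    (hH : ContDiffOn ℝ ∞ H I) (hK : ContDiffOn ℝ ∞ K I) (hH_ne : ∀ u ∈ I, H u ≠ 0)
    (h_nonlinear : ∃ u ∈ I, deriv H u ≠ 0 ∨ deriv K u ≠ 0) :
    ((∃ q : ℝ → ℝ, PossessesSeparableSolution I H K q) ↔
      ∃ (τ : EquivTransformation) (J : Set ℝ) (H' K' q' : ℝ → ℝ),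
        τ.Carries I H K J H' K' ∧ IsListed J H' K' q') ∧
    (∀ q : ℝ → ℝ, PossessesSeparableSolution I H K q ↔
      ∃ (τ : EquivTransformation) (J : Set ℝ) (H' K' q' : ℝ → ℝ),
        τ.Carries I H K J H' K' ∧ IsListed J H' K' q' ∧
        ∃ α β : ℝ, α ≠ 0 ∧ ∀ u ∈ I, q u = α * q' (τ.onU u) + β) := by
  have listed : ∀ q, PossessesSeparableSolution I H K q → HasListedForm I H K q := by
    intro q hq
    obtain ⟨h, h₁, h₂, k, d, c, S⟩ := hq.separationCriterion hI_open hI_conn hH hK hH_ne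
    refine S.hasListedForm hI_open hI_conn hI_ne hH_ne ?_
    -- If `k = 0`, then `H' = 0`, hence also `K' = c H' = 0`, contrary to nonlinearity.
    rintro rfl
    obtain ⟨u, hu, hne⟩ := h_nonlinear
    have dH : HasDerivAt H 0 u := (S.hasDerivAt_H u hu).congr_deriv (by simp)
    have dK : HasDerivAt K 0 u := by
      refine ((dH.const_mul c).congr_deriv (mul_zero c)).congr_of_eventuallyEq ?_
      exact Filter.eventuallyEq_of_mem (hI_open.mem_nhds hu) S.K_eq
    rcases hne with hne | hne
    · exact hne dH.deriv
    · exact hne dK.deriv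
  have possesses : ∀ {q : ℝ → ℝ} {τ : EquivTransformation} {J : Set ℝ} {H' K' q' : ℝ → ℝ}
      {α β : ℝ}, τ.Carries I H K J H' K' → IsListed J H' K' q' → α ≠ 0 →
      (∀ u ∈ I, q u = α * q' (τ.onU u) + β) → PossessesSeparableSolution I H K q := by
    intro q τ J H' K' q' α β hτ hL hα hq
    have hJ : IsOpen J := hτ.1 ▸ τ.isOpen_image hI_open
    obtain ⟨h, h₁, h₂, k, d, c, S⟩ :=
      SeparationCriterion.of_carries hI_open hτ hα hq (hL.separationCriterion hJ)
    exact S.possessesSeparableSolution hI_open hH hH_ne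
  refine ⟨⟨fun ⟨q, hq⟩ => ?_, fun ⟨τ, J, H', K', q', hτ, hL⟩ => ?_⟩,
    fun q => ⟨listed q, fun ⟨τ, J, H', K', q', hτ, hL, α, β, hα, hq⟩ => possesses hτ hL hα hq⟩⟩
  · obtain ⟨τ, J, H', K', q', hτ, hL, -⟩ := listed q hq
    exact ⟨τ, J, H', K', q', hτ, hL⟩
  · exact ⟨fun u => q' (τ.onU u), possesses (α := 1) (β := 0) hτ hL one_ne_zero fun u _ => by simp⟩
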